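/- For an integer $q\ge 2$ and a residue class $a$ mod $q$, let $\Omega(n;q,a)$ be the number of prime factors $p\equiv a \pmod q$ of $n$, counted with multiplicity, put $\lambda(n;q,a)=(-1)^{\Omega(n;q,a)}$, and for residue classes $a_1,\dots,a_r$ mod $q$ put $\lambda(n;q,a_1,\dots,a_r)=\prod_{i=1}^r\lambda(n;q,a_i)$. This function of $n$ is called character-like if there is a non-principal real Dirichlet character $\chi$ mod $q$ such that $\lambda(p;q,a_1,\dots,a_r)=\chi(p)$ for all primes $p\nmid q$ and $\lambda(p;q,a_1,\dots,a_r)=1$ for all primes $p\mid q$. Let $a_1,\dots,a_r$ be distinct residue classes mod $q$, coprime to $q$, with $r=\varphi(q)/2$, and suppose that $\lambda(n;q,a_1,\dots,a_r)$ is not character-like. (In particular, this holds if it is neither character-like nor the complement of a character-like function.) Then: (i) if the generalized Riemann hypothesis holds (every zero in $0<\mathrm{Re}(s)<1$ of every Dirichlet $L$-function, $\zeta(s)$ included, has real part $1/2$), then for every $\epsilon>0$ there is a constant $C=C(q,a_1,\dots,a_r,\epsilon)$ such that $$\Big|\sum_{n\le x}\lambda(n;q,a_1,\dots,a_r)\Big|\le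 C\,x^{1/2+\epsilon}\qquad\text{for all real } x\ge 1;$$ (ii) unconditionally, $$\sum_{n\le x}\lambda(n;q,a_1,\dots,a_r)=o(x)\qquad (x\to\infty).$$ -/

import Mathlib

open Filter Asymptotics

/-- `Ω(n; q, a)`: the number of prime factors of `n`, counted with multiplicity, that are
congruent to `a` modulo `q`. -/
def OmegaAP (q : ℕ) (a : ZMod q) (n : ℕ) : ℕ :=
  (n.primeFactorsList.filter (fun p => (p : ZMod q) = a)).length

/-- `λ(n; q, a) = (-1) ^ Ω(n; q, a)`. -/
def liouvilleAP (q : ℕ) (a : ZMod q) (n : ℕ) : ℤ :=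
  (-1) ^ OmegaAP q a n

/-- `λ(n; q, a₁, …, a_r) = ∏ i, λ(n; q, a_i)`. -/
def liouvilleAPs (q : ℕ) {r : ℕ} (a : Fin r → ZMod q) (n : ℕ) : ℤ :=
  ∏ i, liouvilleAP q (a i) n

/-- The partial sum `L(x; q, a₁, …, a_r) = ∑_{n ≤ x} λ(n; q, a₁, …, a_r)`. -/
noncomputable def liouvilleSum (q : ℕ) {r : ℕ} (a : Fin r → ZMod q) (x : ℝ) : ℝ :=
  ∑ n ∈ Finset.Icc 1 ⌊x⌋₊, (liouvilleAPs q a n : ℝ)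

/-- A completely multiplicative function `f` (here `f = λ(·; q, a₁, …, a_r)`) is character-like
modulo `q` if there is a non-principal real Dirichlet character `χ` modulo `q` such that `f` agrees
with `χ` at the primes not dividing `q`, and is `1` at the primes dividing `q`. In other words, the
Dirichlet series of `f` is `∏_{p ∣ q} (1 - p^{-s})⁻¹ * L(s, χ)`. -/
def IsCharacterLike (q : ℕ) (f : ℕ → ℤ) : Prop :=
  ∃ χ : DirichletCharacter ℝ q, χ ≠ 1 ∧
    (∀ p : ℕ, p.Prime → p ∣ q → f p = 1) ∧
    (∀ p : ℕ, p.Prime → ¬ p ∣ q → (f p : ℝ) = χ (p : ZMod q))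

/-- The generalized Riemann hypothesis for Dirichlet `L`-functions (the modulus `1` gives `ζ`):
every zero in the open critical strip lies on the line `Re s = 1/2`. -/
def GeneralizedRiemannHypothesis : Prop :=
  ∀ (N : ℕ) [NeZero N] (χ : DirichletCharacter ℂ N) (s : ℂ),
    0 < s.re → s.re < 1 → DirichletCharacter.LFunction χ s = 0 → s.re = 1 / 2

/-! At primes `p ∤ q` the function depends only on `p` mod `q`: it is `-1` on `r = φ(q)/2` unit
classes and `1` on the other half, so it has mean zero over the units. Its expansion in Dirichlet
characters therefore has coefficient `c 1 = 0`, and comparing Euler products gives, for `Re s > 1`,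
`F(s) = exp (∑ c χ log L(s, χ) + G(s))` over non-principal `χ`. Here `G` collects the prime-square
terms and the finitely many `p ∣ q`; it is holomorphic in `Re s > 1/2` and bounded in each `Re s ≥ σ
> 1/2` (`LSeries_eq_exp_sum_primeLogSum`). The `c χ` are complex numbers, so one works with branches
of `log L`. No pole of `ζ` intervenes.

Unconditionally, each such `L(s, χ)` is entire and nonzero on `Re s ≥ 1`. Hence `F` extends
continuously to that closed half-plane, and a Wiener–Ikehara type theorem (`summatory_isLittleO`)
gives `o(x)`.

Under GRH each `log L(s, χ)` is holomorphic in `Re s > 1/2`. Borel–Carathéodory followed by the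
three lines theorem makes it `o(log |t|)` on each `Re s ≥ σ > 1/2` (`norm_le_mul_log_add`), so `F(s)
= O(|t|^η)` for every `η > 0`. A smoothed Perron formula, shifted to a line just right of `1/2` and
then differenced over an interval of length `√x`, gives `O(x^(1/2+ε))`
(`exists_norm_summatory_le_rpow`). -/

/-! ### Complete multiplicativity of λ -/

theorem OmegaAP_eq (q : ℕ) (b : ZMod q) (n : ℕ) :
    OmegaAP q b n
      = ((n.primeFactorsList.map (Nat.cast : ℕ → ZMod q)).filter fun p => p = b).length := by
  simp [OmegaAP, List.map_eq_flatMap]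

theorem OmegaAP_mul (q : ℕ) (b : ZMod q) {m n : ℕ} (hm : m ≠ 0) (hn : n ≠ 0) :
    OmegaAP q b (m * n) = OmegaAP q b m + OmegaAP q b n := by
  rw [OmegaAP_eq, OmegaAP_eq, OmegaAP_eq,
    (((Nat.perm_primeFactorsList_mul hm hn).map _).filter _).length_eq, List.map_append,
    List.filter_append, List.length_append]

theorem liouvilleAPs_mul (q : ℕ) {r : ℕ} (a : Fin r → ZMod q) {m n : ℕ} (hm : m ≠ 0)
    (hn : n ≠ 0) : liouvilleAPs q a (m * n) = liouvilleAPs q a m * liouvilleAPs q a n := by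
  simp only [liouvilleAPs, liouvilleAP, OmegaAP_mul q _ hm hn, pow_add, Finset.prod_mul_distrib]

theorem liouvilleAPs_one (q : ℕ) {r : ℕ} (a : Fin r → ZMod q) : liouvilleAPs q a 1 = 1 := by
  simp [liouvilleAPs, liouvilleAP, OmegaAP]

theorem abs_liouvilleAPs (q : ℕ) {r : ℕ} (a : Fin r → ZMod q) (n : ℕ) :
    |liouvilleAPs q a n| = 1 := by
  simp [liouvilleAPs, liouvilleAP, Finset.abs_prod]

open Classical in
theorem liouvilleAPs_prime (q : ℕ) {r : ℕ} (a : Fin r → ZMod q) (ha : Function.Injective a)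
    {p : ℕ} (hp : p.Prime) :
    liouvilleAPs q a p = if (p : ZMod q) ∈ Finset.univ.image a then -1 else 1 := by
  have h (b : ZMod q) : OmegaAP q b p = if (p : ZMod q) = b then 1 else 0 := by
    rw [OmegaAP_eq, Nat.primeFactorsList_prime hp]
    split_ifs with h <;> simp [h]
  simp only [liouvilleAPs, liouvilleAP, h]
  split_ifs with hmem
  · obtain ⟨i, -, hi⟩ := Finset.mem_image.mp hmem
    rw [Finset.prod_eq_single i]
    · simp [hi]
    · intro j _ hj
      have : (p : ZMod q) ≠ a j := by rw [← hi]; exact fun h => hj (ha h.symm)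
      simp [this]
    · simp
  · refine Finset.prod_eq_one fun i _ => ?_
    have : (p : ZMod q) ≠ a i := fun h => hmem (Finset.mem_image.mpr ⟨i, Finset.mem_univ _, h.symm⟩)
    simp [this]

/-- The function `λ(·; q, a₁, …, a_r)`, with the value `0` at `0`, as a complex-valued
completely multiplicative function. -/
noncomputable def liouvilleHom (q : ℕ) {r : ℕ} (a : Fin r → ZMod q) : ℕ →*₀ ℂ where
  toFun n := if n = 0 then 0 else (liouvilleAPs q a n : ℂ)
  map_zero' := by simp
  map_one' := by simp [liouvilleAPs_one]
  map_mul' m n := by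
    by_cases hm : m = 0
    · simp [hm]
    by_cases hn : n = 0
    · simp [hn]
    simp [hm, hn, liouvilleAPs_mul q a hm hn]

theorem liouvilleHom_apply (q : ℕ) {r : ℕ} (a : Fin r → ZMod q) {n : ℕ} (hn : n ≠ 0) :
    liouvilleHom q a n = (liouvilleAPs q a n : ℂ) := by
  simp [liouvilleHom, hn]

theorem norm_liouvilleHom_le (q : ℕ) {r : ℕ} (a : Fin r → ZMod q) (n : ℕ) :
    ‖liouvilleHom q a n‖ ≤ 1 := by
  by_cases hn : n = 0
  · simp [hn]
  rw [liouvilleHom_apply q a hn, Complex.norm_intCast]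
  exact_mod_cast (abs_liouvilleAPs q a n).le

theorem ofReal_liouvilleSum (q : ℕ) {r : ℕ} (a : Fin r → ZMod q) (x : ℝ) :
    (liouvilleSum q a x : ℂ) = ∑ n ∈ Finset.Icc 1 ⌊x⌋₊, liouvilleHom q a n := by
  unfold liouvilleSum
  push_cast
  refine Finset.sum_congr rfl fun n hn => ?_
  rw [liouvilleHom_apply q a (by have := (Finset.mem_Icc.mp hn).1; omega)]

/-! ### Expansion in Dirichlet characters -/

/-- A function on the residue classes with vanishing sum over the units is, on the units, a
combination of the non-principal Dirichlet characters. -/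
theorem exists_coeff_dirichletCharacter (q : ℕ) [NeZero q] (g : ZMod q → ℂ)
    (hg : ∑ b : (ZMod q)ˣ, g b = 0) :
    ∃ c : DirichletCharacter ℂ q → ℂ, c 1 = 0 ∧
      ∀ b : ZMod q, IsUnit b → g b = ∑ χ : DirichletCharacter ℂ q, c χ * χ b := by
  have hφ : (q.totient : ℂ) ≠ 0 := by
    exact_mod_cast (Nat.totient_pos.mpr (NeZero.pos q)).ne'
  -- Fourier coefficients on the unit group; the one at the principal character is the mean of `g`.
  refine ⟨fun χ => (q.totient : ℂ)⁻¹ * ∑ b : (ZMod q)ˣ, g b * χ (b : ZMod q)⁻¹, ?_, ?_⟩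
  · have (b : (ZMod q)ˣ) : (1 : DirichletCharacter ℂ q) (b : ZMod q)⁻¹ = 1 := by
      rw [ZMod.inv_coe_unit, MulChar.one_apply_coe]
    simp only [this, mul_one, hg, mul_zero]
  · intro b hb
    obtain ⟨u, rfl⟩ := hb
    simp only [mul_assoc, ← Finset.mul_sum, Finset.sum_mul]
    rw [Finset.sum_comm]
    simp only [← Finset.mul_sum, DirichletCharacter.sum_char_inv_mul_char_eq ℂ (Units.isUnit _),
      Units.val_inj]
    simp
    field_simp

/-- The values `-1` and `1` add up to `φ(q) - 2r = 0` over the units. This is where `r = φ(q)/2`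
enters. -/
theorem exists_coeff_liouvilleHom (q r : ℕ) (hq : 2 ≤ q) (a : Fin r → ZMod q)
    (ha_distinct : Function.Injective a) (ha_coprime : ∀ i, IsUnit (a i))
    (hr : 2 * r = Nat.totient q) :
    ∃ c : DirichletCharacter ℂ q → ℂ, c 1 = 0 ∧ ∀ p : ℕ, p.Prime → ¬ p ∣ q →
      liouvilleHom q a p = ∑ χ : DirichletCharacter ℂ q, c χ * χ p := by
  classical
  have : NeZero q := ⟨by omega⟩
  obtain ⟨c, hc, h⟩ := exists_coeff_dirichletCharacter q
    (fun b => if b ∈ Finset.univ.image a then -1 else 1) (by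
      have h1 : ∑ b : (ZMod q)ˣ, (if (b : ZMod q) ∈ Finset.univ.image a then (-1 : ℂ) else 1)
          = ∑ b : (ZMod q)ˣ, (1 - 2 * ∑ i, if (b : ZMod q) = a i then (1 : ℂ) else 0) := by
        refine Finset.sum_congr rfl fun b _ => ?_
        split_ifs with hb
        · obtain ⟨i, -, hi⟩ := Finset.mem_image.mp hb
          rw [Finset.sum_eq_single i]
          · simp [hi]; norm_num
          · intro j _ hj
            rw [if_neg]
            rw [← hi]
            exact fun h => hj (ha_distinct h.symm)
          · simp
        · rw [Finset.sum_eq_zero]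
          · simp
          · intro i _
            rw [if_neg fun h => hb (Finset.mem_image.mpr ⟨i, Finset.mem_univ _, h.symm⟩)]
      rw [h1, Finset.sum_sub_distrib, ← Finset.mul_sum, Finset.sum_comm]
      have h2 (i : Fin r) : ∑ b : (ZMod q)ˣ, (if (b : ZMod q) = a i then (1 : ℂ) else 0) = 1 := by
        obtain ⟨u, hu⟩ := ha_coprime i
        simp [← hu, Units.val_inj]
      simp only [h2]
      simp only [Finset.sum_const, Finset.card_univ, ZMod.card_units_eq_totient, ← hr]
      simp)
  refine ⟨c, hc, fun p hp hpq => ?_⟩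
  rw [← h p ((ZMod.isUnit_iff_coprime p q).mpr (hp.coprime_iff_not_dvd.mpr hpq)),
    liouvilleHom_apply q a hp.ne_zero, liouvilleAPs_prime q a ha_distinct hp]
  split_ifs <;> simp

/-! ### Logarithms of Euler products -/

/-- The radius `3/4` exceeds `2^(-1/2)`, so every Euler factor with `Re s ≥ 1/2` is covered. -/
theorem norm_log_one_sub_add_le {z : ℂ} (hz : ‖z‖ ≤ 3 / 4) :
    ‖Complex.log (1 - z) + z‖ ≤ 2 * ‖z‖ ^ 2 := by
  have h := Complex.norm_log_one_add_sub_self_le (z := -z) (by rw [norm_neg]; linarith)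
  rw [norm_neg, sub_neg_eq_add, ← sub_eq_add_neg] at h
  refine h.trans ?_
  have h1 : (1 - ‖z‖)⁻¹ ≤ 4 := by
    rw [inv_le_comm₀ (by linarith) (by norm_num)]
    linarith
  nlinarith [mul_le_mul_of_nonneg_left h1 (sq_nonneg ‖z‖)]

theorem norm_log_one_sub_le {z : ℂ} (hz : ‖z‖ ≤ 3 / 4) :
    ‖Complex.log (1 - z)‖ ≤ 3 * ‖z‖ := by
  have h := norm_log_one_sub_add_le hz
  have h1 : ‖Complex.log (1 - z)‖ ≤ ‖Complex.log (1 - z) + z‖ + ‖z‖ := by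
    simpa using norm_sub_le (Complex.log (1 - z) + z) z
  nlinarith [norm_nonneg z]

theorem norm_mul_natCast_cpow_le {g : ℕ → ℂ} (hg : ∀ n, ‖g n‖ ≤ 1) {n : ℕ} (hn : 0 < n)
    {s : ℂ} {σ : ℝ} (hs : σ ≤ s.re) : ‖g n * (n : ℂ) ^ (-s)‖ ≤ (n : ℝ) ^ (-σ) := by
  rw [norm_mul, Complex.norm_natCast_cpow_of_pos hn, Complex.neg_re]
  refine (mul_le_of_le_one_left (by positivity) (hg n)).trans ?_
  exact Real.rpow_le_rpow_of_exponent_le (by exact_mod_cast hn) (by linarith)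

theorem natCast_rpow_neg_le {n : ℕ} (hn : 2 ≤ n) {σ : ℝ} (hσ : 1 / 2 ≤ σ) :
    (n : ℝ) ^ (-σ) ≤ 3 / 4 := by
  have h2 : (2 : ℝ) ≤ n := by exact_mod_cast hn
  calc (n : ℝ) ^ (-σ) ≤ (n : ℝ) ^ (-(1 / 2 : ℝ)) :=
        Real.rpow_le_rpow_of_exponent_le (by linarith) (by linarith)
    _ ≤ 2 ^ (-(1 / 2 : ℝ)) := Real.rpow_le_rpow_of_nonpos (by norm_num) h2 (by norm_num)
    _ ≤ 3 / 4 := by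
      rw [Real.rpow_neg (by norm_num), ← Real.sqrt_eq_rpow, inv_le_comm₀ (by positivity)
        (by norm_num)]
      exact Real.le_sqrt_of_sq_le (by norm_num)

theorem differentiableAt_log_one_sub_mul_cpow {w : ℂ} {n : ℕ} (hn : 0 < n) {s : ℂ}
    (h : ‖w * (n : ℂ) ^ (-s)‖ ≤ 3 / 4) :
    DifferentiableAt ℂ (fun s => Complex.log (1 - w * (n : ℂ) ^ (-s))) s := by
  have hn0 : (n : ℂ) ≠ 0 := by exact_mod_cast hn.ne'
  refine DifferentiableAt.clog ?_ ?_
  · exact (differentiableAt_const _).sub ((differentiableAt_const _).mul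
      ((differentiableAt_id.neg).const_cpow (Or.inl hn0)))
  · refine Complex.mem_slitPlane_of_norm_lt_one (z := -(w * (n : ℂ) ^ (-s))) ?_ |> fun h => by
      simpa [sub_eq_add_neg] using h
    rw [norm_neg]
    linarith

/-- The logarithm `∑_p -log (1 - g(p) p⁻ˢ)` of an Euler product. -/
noncomputable def primeLogSum (g : ℕ → ℂ) (s : ℂ) : ℂ :=
  ∑' p : Nat.Primes, -Complex.log (1 - g p * ((p : ℕ) : ℂ) ^ (-s))

section
variable {g : ℕ → ℂ} (hg : ∀ n, ‖g n‖ ≤ 1)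
include hg

theorem norm_primeLogSum_term_le {s : ℂ} {σ : ℝ} (hσ : 1 / 2 ≤ σ) (hs : σ ≤ s.re)
    (p : Nat.Primes) :
    ‖-Complex.log (1 - g p * ((p : ℕ) : ℂ) ^ (-s))‖ ≤ 3 * ((p : ℕ) : ℝ) ^ (-σ) := by
  have h1 := norm_mul_natCast_cpow_le hg p.2.pos hs
  rw [norm_neg]
  refine (norm_log_one_sub_le (h1.trans (natCast_rpow_neg_le p.2.two_le hσ))).trans ?_
  linarith

theorem differentiableOn_primeLogSum_term (p : Nat.Primes) :
    DifferentiableOn ℂ (fun s => Complex.log (1 - g p * ((p : ℕ) : ℂ) ^ (-s)))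
      {s : ℂ | 1 / 2 ≤ s.re} := fun s hs =>
  (differentiableAt_log_one_sub_mul_cpow p.2.pos
    ((norm_mul_natCast_cpow_le hg p.2.pos (le_refl s.re)).trans
      (natCast_rpow_neg_le p.2.two_le hs))).differentiableWithinAt

theorem summable_primeLogSum_term {s : ℂ} (hs : 1 < s.re) :
    Summable fun p : Nat.Primes => -Complex.log (1 - g p * ((p : ℕ) : ℂ) ^ (-s)) := by
  refine Summable.of_norm_bounded (g := fun p : Nat.Primes => 3 * ((p : ℕ) : ℝ) ^ (-s.re))
    ((Nat.Primes.summable_rpow.mpr (by linarith)).mul_left 3) fun p => ?_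
  exact norm_primeLogSum_term_le hg (by linarith) le_rfl p

theorem norm_primeLogSum_le {s : ℂ} {σ : ℝ} (hσ : 1 < σ) (hs : σ ≤ s.re) :
    ‖primeLogSum g s‖ ≤ ∑' p : Nat.Primes, 3 * ((p : ℕ) : ℝ) ^ (-σ) :=
  tsum_of_norm_bounded ((Nat.Primes.summable_rpow.mpr (by linarith)).mul_left 3).hasSum
    (norm_primeLogSum_term_le hg (by linarith) hs)

theorem differentiableOn_primeLogSum : DifferentiableOn ℂ (primeLogSum g) {s | 1 < s.re} := by
  intro s hs
  simp only [Set.mem_ofPred_eq] at hs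
  obtain ⟨σ, h1, h2⟩ := exists_between hs
  have hU : IsOpen {s : ℂ | σ < s.re} := isOpen_lt continuous_const Complex.continuous_re
  have := Complex.differentiableOn_tsum_of_summable_norm
    (F := fun (p : Nat.Primes) s => -Complex.log (1 - g p * ((p : ℕ) : ℂ) ^ (-s)))
    ((Nat.Primes.summable_rpow.mpr (by linarith : -σ < -1)).mul_left 3)
    (fun p => ((differentiableOn_primeLogSum_term hg p).mono
      (fun z (hz : σ < z.re) => (by simp only [Set.mem_ofPred_eq]; linarith))).neg) hU
    (fun p w hw => norm_primeLogSum_term_le hg (by linarith) (le_of_lt hw) p)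
  exact (this.differentiableAt (hU.mem_nhds h2)).differentiableWithinAt

end

theorem exp_primeLogSum (f : ℕ →*₀ ℂ) (hf : ∀ n, ‖f n‖ ≤ 1) {s : ℂ} (hs : 1 < s.re) :
    Complex.exp (primeLogSum f s) = LSeries f s := by
  have hs0 : -s ≠ 0 := fun h => by
    rw [neg_eq_zero] at h; simp [h] at hs; linarith
  let F : ℕ →*₀ ℂ :=
    { toFun := fun n => f n * (n : ℂ) ^ (-s)
      map_zero' := by simp
      map_one' := by simp
      map_mul' := fun m n => by
        simp only [map_mul, Nat.cast_mul, Complex.natCast_mul_natCast_cpow]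
        ring }
  have hF (n : ℕ) : F n = f n * (n : ℂ) ^ (-s) := rfl
  have hsum : Summable (‖F ·‖) := by
    refine Summable.of_nonneg_of_le (fun _ => norm_nonneg _) (fun n => ?_)
      (Real.summable_nat_rpow.mpr (by linarith : -s.re < -1))
    rcases Nat.eq_zero_or_pos n with rfl | hn
    · simp; positivity
    · exact norm_mul_natCast_cpow_le hf hn le_rfl
  have := EulerProduct.exp_tsum_primes_log_eq_tsum hsum
  simp only [hF] at this
  rw [primeLogSum, this, LSeries]
  refine tsum_congr fun n => ?_
  rw [LSeries.term_def₀ (map_zero f)]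

/-- If a completely multiplicative function `f` is a linear combination of Dirichlet characters at
the primes not dividing `q`, then its Dirichlet series is the corresponding product of powers
of Dirichlet `L`-functions, up to a factor `exp G` with `G` holomorphic in `Re s > 1/2`. -/
theorem LSeries_eq_exp_sum_primeLogSum (q : ℕ) [NeZero q] (f : ℕ →*₀ ℂ) (hf : ∀ n, ‖f n‖ ≤ 1)
    (c : DirichletCharacter ℂ q → ℂ)
    (hc : ∀ p : ℕ, p.Prime → ¬ p ∣ q → f p = ∑ χ : DirichletCharacter ℂ q, c χ * χ p) :
    ∃ G : ℂ → ℂ, DifferentiableOn ℂ G {s | 1 / 2 < s.re} ∧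
      (∀ σ : ℝ, 1 / 2 < σ → ∃ B, ∀ s : ℂ, σ ≤ s.re → ‖G s‖ ≤ B) ∧
      ∀ s : ℂ, 1 < s.re → LSeries f s = Complex.exp
        (∑ χ : DirichletCharacter ℂ q, c χ * primeLogSum (fun n => χ n) s + G s) := by
  have hχ (χ : DirichletCharacter ℂ q) (n : ℕ) : ‖χ n‖ ≤ 1 := χ.norm_le_one _
  -- The discrepancy at `p` between `log F` and `∑ c χ log L(s, χ)`. For `p ∤ q` the terms linear in
  -- `p^(-s)` cancel by `hc`, so the sum over `p` converges beyond `Re s > 1`.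
  set E : Nat.Primes → ℂ → ℂ := fun p s => -Complex.log (1 - f p * ((p : ℕ) : ℂ) ^ (-s)) +
    ∑ χ : DirichletCharacter ℂ q, c χ * Complex.log (1 - χ p * ((p : ℕ) : ℂ) ^ (-s)) with hE
  set K : ℝ := 2 * (1 + ∑ χ : DirichletCharacter ℂ q, ‖c χ‖) with hK
  -- The first term bounds the quadratic remainders; the second bounds `f p * p^(-s)` at the
  -- finitely many `p ∣ q`, where all `χ p` vanish.
  let u : ℝ → Nat.Primes → ℝ := fun σ p =>
    K * ((p : ℕ) : ℝ) ^ (-(2 * σ)) + if (p : ℕ) ∣ q then 1 else 0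
  have hu {σ : ℝ} (hσ : 1 / 2 < σ) : Summable (u σ) := by
    refine ((Nat.Primes.summable_rpow.mpr (by linarith)).mul_left K).add ?_
    refine summable_of_hasFiniteSupport (Set.Finite.subset
      (Set.Finite.preimage (Subtype.val_injective.injOn) (Set.finite_Icc 0 q)) fun p hp => ?_)
    have : (p : ℕ) ∣ q := by
      by_contra h
      exact hp (if_neg h)
    exact ⟨Nat.zero_le _, Nat.le_of_dvd (NeZero.pos q) this⟩
  have hEu {σ : ℝ} (hσ : 1 / 2 < σ) (p : Nat.Primes) {s : ℂ} (hs : σ ≤ s.re) :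
      ‖E p s‖ ≤ u σ p := by
    have hb : ((p : ℕ) : ℝ) ^ (-σ) ≤ 3 / 4 := natCast_rpow_neg_le p.2.two_le hσ.le
    have hsq : (((p : ℕ) : ℝ) ^ (-σ)) ^ 2 = ((p : ℕ) : ℝ) ^ (-(2 * σ)) := by
      rw [← Real.rpow_natCast, ← Real.rpow_mul (by positivity)]
      congr 1; push_cast; ring
    have key {g : ℕ → ℂ} (hg : ∀ n, ‖g n‖ ≤ 1) :
        ‖Complex.log (1 - g p * ((p : ℕ) : ℂ) ^ (-s)) + g p * ((p : ℕ) : ℂ) ^ (-s)‖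
          ≤ 2 * ((p : ℕ) : ℝ) ^ (-(2 * σ)) := by
      have h1 := norm_mul_natCast_cpow_le hg p.2.pos hs
      refine (norm_log_one_sub_add_le (h1.trans hb)).trans ?_
      rw [← hsq]
      gcongr
    have hdec : E p s = -(Complex.log (1 - f p * ((p : ℕ) : ℂ) ^ (-s))
          + f p * ((p : ℕ) : ℂ) ^ (-s))
        + ∑ χ : DirichletCharacter ℂ q, c χ * (Complex.log (1 - χ p * ((p : ℕ) : ℂ) ^ (-s))
          + χ p * ((p : ℕ) : ℂ) ^ (-s))
        + (f p - ∑ χ : DirichletCharacter ℂ q, c χ * χ p) * ((p : ℕ) : ℂ) ^ (-s) := by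
      simp only [hE, mul_add, Finset.sum_add_distrib, sub_mul, Finset.sum_mul, mul_assoc]
      ring
    have h3 : ‖(f p - ∑ χ : DirichletCharacter ℂ q, c χ * χ p) * ((p : ℕ) : ℂ) ^ (-s)‖
        ≤ if (p : ℕ) ∣ q then 1 else 0 := by
      split_ifs with hpq
      · have (χ : DirichletCharacter ℂ q) : χ p = 0 := by
          refine χ.map_nonunit fun h => ?_
          rw [ZMod.isUnit_iff_coprime] at h
          exact (p.2.coprime_iff_not_dvd.mp h) hpq
        simp only [this, mul_zero, Finset.sum_const_zero, sub_zero]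
        exact (norm_mul_natCast_cpow_le hf p.2.pos hs).trans (hb.trans (by norm_num))
      · rw [hc p p.2 hpq]
        simp
    rw [hdec]
    refine (norm_add_le _ _).trans (add_le_add ((norm_add_le _ _).trans ?_) h3)
    rw [norm_neg]
    refine (add_le_add (key hf) ((norm_sum_le _ _).trans (Finset.sum_le_sum fun χ _ =>
      (norm_mul_le _ _).trans (mul_le_mul_of_nonneg_left (key (hχ χ)) (norm_nonneg _))))).trans ?_
    rw [← Finset.sum_mul, hK]
    exact le_of_eq (by ring)
  refine ⟨fun s => ∑' p, E p s, ?_, ?_, ?_⟩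
  · intro s hs
    simp only [Set.mem_ofPred_eq] at hs
    obtain ⟨σ, h1, h2⟩ := exists_between hs
    have hU : IsOpen {s : ℂ | σ < s.re} := isOpen_lt continuous_const Complex.continuous_re
    have hsub : {s : ℂ | σ < s.re} ⊆ {s : ℂ | 1 / 2 ≤ s.re} := fun z (hz : σ < z.re) => by
      simp only [Set.mem_ofPred_eq]; linarith
    refine ((Complex.differentiableOn_tsum_of_summable_norm (hu h1) (fun p => ?_) hU
      (fun p w hw => hEu h1 p (le_of_lt hw))).differentiableAt
      (hU.mem_nhds h2)).differentiableWithinAt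
    refine ((differentiableOn_primeLogSum_term hf p).mono hsub).neg.add
      (DifferentiableOn.fun_sum fun χ _ => DifferentiableOn.const_mul
        ((differentiableOn_primeLogSum_term (hχ χ) p).mono hsub) _)
  · intro σ hσ
    exact ⟨∑' p, u σ p, fun s hs => tsum_of_norm_bounded (hu hσ).hasSum fun p => hEu hσ p hs⟩
  · intro s hs
    rw [← exp_primeLogSum f hf hs]
    congr 1
    have h1 : Summable fun p => E p s :=
      Summable.of_norm_bounded (hu (by linarith : 1 / 2 < s.re)) fun p =>
        hEu (by linarith) p le_rfl
    have h2 (χ : DirichletCharacter ℂ q) := summable_primeLogSum_term (hχ χ) hs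
    unfold primeLogSum
    simp only [← tsum_mul_left]
    rw [← Summable.tsum_finsetSum fun χ _ => (h2 χ).mul_left (c χ), ← Summable.tsum_add
      (summable_sum fun χ _ => (h2 χ).mul_left (c χ)) h1]
    refine tsum_congr fun p => ?_
    simp only [hE, mul_neg, Finset.sum_neg_distrib]
    ring

/-! ### Branches of log L(s, χ) -/

open scoped Topology in
/-- A continuous branch of the logarithm of a holomorphic function is holomorphic. -/
theorem differentiableOn_of_exp_eq {l g : ℂ → ℂ} {U : Set ℂ} (hU : IsOpen U)
    (hl : ContinuousOn l U) (hg : DifferentiableOn ℂ g U)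
    (h : ∀ z ∈ U, Complex.exp (l z) = g z) : DifferentiableOn ℂ l U := by
  intro z hz
  have hgz : g z ≠ 0 := by rw [← h z hz]; exact Complex.exp_ne_zero _
  have hlz : ContinuousAt l z := hl.continuousAt (hU.mem_nhds hz)
  -- Near `z` continuity gives `|Im (l w - l z)| < 1 < π`, so `l` equals this holomorphic expression
  -- built from the principal logarithm.
  have hd : DifferentiableAt ℂ (fun w => l z + Complex.log (g w / g z)) z := by
    refine (differentiableAt_const _).add (DifferentiableAt.clog
      ((hg.differentiableAt (hU.mem_nhds hz)).div_const _) ?_)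
    rw [div_self hgz]
    exact Complex.one_mem_slitPlane
  refine (hd.congr_of_eventuallyEq ?_).differentiableWithinAt
  have hnear : ∀ᶠ w in 𝓝 z, ‖l w - l z‖ < 1 := by
    have : Tendsto (fun w => ‖l w - l z‖) (𝓝 z) (𝓝 ‖l z - l z‖) :=
      (hlz.sub continuousAt_const).norm
    exact this.eventually_lt_const (by simp)
  filter_upwards [hnear, hU.mem_nhds hz] with w hw hwU
  have him : |(l w - l z).im| < 1 := (Complex.abs_im_le_norm _).trans_lt hw
  have hpi := Real.pi_gt_three
  rw [← h w hwU, ← h z hz, ← Complex.exp_sub, Complex.log_exp]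
  · ring
  · linarith [(abs_lt.mp him).1]
  · linarith [(abs_lt.mp him).2]

/-- Differentiating `exp (l₂ - l₁) = 1` shows that `l₂ - l₁` has derivative zero on a connected open
set. -/
theorem exists_eq_add_of_exp_eq {l₁ l₂ : ℂ → ℂ} {U : Set ℂ} (hU : IsOpen U)
    (hc : IsPreconnected U) (h₁ : DifferentiableOn ℂ l₁ U) (h₂ : DifferentiableOn ℂ l₂ U)
    (h : ∀ z ∈ U, Complex.exp (l₁ z) = Complex.exp (l₂ z)) :
    ∃ k : ℂ, ∀ z ∈ U, l₂ z = l₁ z + k := by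
  have hd : ∀ z ∈ U, deriv (fun w => l₂ w - l₁ w) z = 0 := by
    intro z hz
    have hdz := (h₂.differentiableAt (hU.mem_nhds hz)).fun_sub (h₁.differentiableAt (hU.mem_nhds hz))
    have h1 := hdz.hasDerivAt.cexp
    have h2 : (fun w => Complex.exp (l₂ w - l₁ w)) =ᶠ[nhds z] fun _ => 1 := by
      filter_upwards [hU.mem_nhds hz] with w hw
      rw [Complex.exp_sub, h w hw, div_self (Complex.exp_ne_zero _)]
    have h3 := h1.unique ((hasDerivAt_const z (1 : ℂ)).congr_of_eventuallyEq h2)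
    exact (mul_eq_zero.mp h3).resolve_left (Complex.exp_ne_zero _)
  obtain ⟨k, hk⟩ := hU.exists_is_const_of_deriv_eq_zero hc (h₂.fun_sub h₁)
    (fun z hz => hd z hz)
  exact ⟨k, fun z hz => by rw [← hk z hz]; ring⟩

theorem isSimplyConnected_of_convex {U : Set ℂ} (hU : Convex ℝ U) (hne : U.Nonempty) :
    IsSimplyConnected U := by
  have := hU.contractibleSpace hne
  exact SimplyConnectedSpace.ofContractible U

theorem isOpen_lt_re (σ : ℝ) : IsOpen {s : ℂ | σ < s.re} :=
  isOpen_lt continuous_const Complex.continuous_re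

theorem exp_primeLogSum_dirichletCharacter {q : ℕ} [NeZero q] (χ : DirichletCharacter ℂ q)
    {s : ℂ} (hs : 1 < s.re) :
    Complex.exp (primeLogSum (fun n => χ n) s) = DirichletCharacter.LFunction χ s := by
  rw [DirichletCharacter.LFunction_eq_LSeries χ hs,
    ← DirichletCharacter.LSeries_eulerProduct_exp_log χ hs]
  rfl

/-- Lets a branch obtained by lifting on a larger domain be normalised to agree with the
Euler-product logarithm. -/
theorem exists_branch_eq_primeLogSum {q : ℕ} [NeZero q] {χ : DirichletCharacter ℂ q}
    (hχ : χ ≠ 1) {l : ℂ → ℂ} (hl : ContinuousOn l {s | 1 < s.re})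
    (h : ∀ s : ℂ, 1 < s.re → Complex.exp (l s) = DirichletCharacter.LFunction χ s) :
    ∃ k : ℂ, ∀ s : ℂ, 1 < s.re → primeLogSum (fun n => χ n) s = l s + k := by
  have hU := isOpen_lt_re 1
  refine exists_eq_add_of_exp_eq hU (convex_halfSpace_re_gt 1).isPreconnected
    (differentiableOn_of_exp_eq hU hl
      (DirichletCharacter.differentiable_LFunction hχ).differentiableOn h)
    (differentiableOn_primeLogSum fun n => χ.norm_le_one _) fun z hz => ?_
  rw [h z hz, exp_primeLogSum_dirichletCharacter χ hz]

/-- `log L(s, χ)` extends continuously to `Re s ≥ 1` for non-principal `χ`. -/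
theorem exists_continuousOn_eq_primeLogSum {q : ℕ} [NeZero q] {χ : DirichletCharacter ℂ q}
    (hχ : χ ≠ 1) : ∃ l : ℂ → ℂ, ContinuousOn l {s | 1 ≤ s.re} ∧
      ∀ s : ℂ, 1 < s.re → l s = primeLogSum (fun n => χ n) s := by
  -- Retraction of the plane onto `Re s ≥ 1`. The lifting theorem is applied on an open set, so `L ∘
  -- ρ`, which has no zeros, is lifted on the whole plane.
  let ρ : ℂ → ℂ := fun s => (max s.re 1 : ℝ) + s.im * Complex.I
  have hρ : Continuous ρ := by fun_prop
  have hρre (s : ℂ) : 1 ≤ (ρ s).re := by simp [ρ]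
  have hρid {s : ℂ} (hs : 1 ≤ s.re) : ρ s = s := by
    simp [ρ, max_eq_left hs]
  obtain ⟨l, hl, he⟩ := Complex.exists_continuousOn_eqOn_exp_comp
    (isSimplyConnected_of_convex (convex_univ) Set.univ_nonempty) isOpen_univ
    (g := fun s => DirichletCharacter.LFunction χ (ρ s))
    ((DirichletCharacter.differentiable_LFunction hχ).continuous.comp hρ).continuousOn
    (by
      rintro ⟨s, -, hs⟩
      exact DirichletCharacter.LFunction_ne_zero_of_one_le_re χ (Or.inl hχ) (hρre s) hs)
  obtain ⟨k, hk⟩ := exists_branch_eq_primeLogSum hχ (hl.mono (Set.subset_univ _)) (fun s hs => by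
    have := he (Set.mem_univ s)
    simp only [Function.comp_apply, hρid hs.le] at this
    exact this)
  exact ⟨fun s => l s + k, (hl.mono (Set.subset_univ _)).add continuousOn_const,
    fun s hs => (hk s hs).symm⟩

/-- On the Riemann hypothesis for `L(s, χ)`, its logarithm is holomorphic in `Re s > 1/2`. -/
theorem exists_differentiableOn_eq_primeLogSum {q : ℕ} [NeZero q] {χ : DirichletCharacter ℂ q}
    (hχ : χ ≠ 1) (hL : ∀ s : ℂ, 1 / 2 < s.re → DirichletCharacter.LFunction χ s ≠ 0) :
    ∃ l : ℂ → ℂ, DifferentiableOn ℂ l {s | 1 / 2 < s.re} ∧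
      (∀ s : ℂ, 1 / 2 < s.re → ‖DirichletCharacter.LFunction χ s‖ = Real.exp (l s).re) ∧
      ∀ s : ℂ, 1 < s.re → l s = primeLogSum (fun n => χ n) s := by
  have hU := isOpen_lt_re (1 / 2)
  have hLd := DirichletCharacter.differentiable_LFunction hχ
  obtain ⟨l, hl, he⟩ := Complex.exists_continuousOn_eqOn_exp_comp
    (isSimplyConnected_of_convex (convex_halfSpace_re_gt (1 / 2))
      ⟨1, by simp only [Set.mem_ofPred_eq, Complex.one_re]; norm_num⟩) hU
    (g := DirichletCharacter.LFunction χ) hLd.continuous.continuousOn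
    (by
      rintro ⟨s, hs, hs0⟩
      exact hL s hs hs0)
  have hsub : {s : ℂ | 1 < s.re} ⊆ {s : ℂ | 1 / 2 < s.re} := fun s (hs : 1 < s.re) => by
    simp only [Set.mem_ofPred_eq]; linarith
  obtain ⟨k, hk⟩ := exists_branch_eq_primeLogSum hχ (hl.mono hsub) (fun s hs => he (hsub hs))
  -- Evaluating at `s = 2` shows that adding `k` does not change the exponential, so `l + k` is
  -- still a logarithm of `L` on `Re s > 1/2`.
  have hek : Complex.exp k = 1 := by
    have h2 : (1 : ℝ) < (2 : ℂ).re := by norm_num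
    have h1 := exp_primeLogSum_dirichletCharacter χ h2
    rw [hk 2 h2, Complex.exp_add] at h1
    have h3 : Complex.exp (l 2) = DirichletCharacter.LFunction χ 2 := he (hsub h2)
    rw [h3] at h1
    exact mul_left_cancel₀ (hL 2 (hsub h2)) (by rw [h1, mul_one])
  refine ⟨fun s => l s + k, (differentiableOn_of_exp_eq hU hl hLd.differentiableOn he).add_const _,
    fun s hs => ?_, fun s hs => (hk s hs).symm⟩
  rw [← Complex.norm_exp, Complex.exp_add, hek, mul_one]
  exact congrArg _ (he hs).symm

/-! ### Summatory functions and Mellin transforms -/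

/-- The summatory function `∑_{n ≤ x} f(n)`. -/
noncomputable def summatory (f : ℕ → ℂ) (x : ℝ) : ℂ := ∑ n ∈ Finset.Icc 1 ⌊x⌋₊, f n

theorem summatory_of_lt_one (f : ℕ → ℂ) {x : ℝ} (hx : x < 1) : summatory f x = 0 := by
  simp [summatory, Nat.floor_eq_zero.mpr hx]

theorem measurable_summatory (f : ℕ → ℂ) : Measurable (summatory f) :=
  (measurable_from_nat (f := fun m => ∑ n ∈ Finset.Icc 1 m, f n)).comp Nat.measurable_floor

theorem norm_summatory_sub_le {f : ℕ → ℂ} (hf : ∀ n, ‖f n‖ ≤ 1) {x y : ℝ} (hx : 0 ≤ x)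
    (hxy : x ≤ y) : ‖summatory f y - summatory f x‖ ≤ y - x + 1 := by
  have hfl : ⌊x⌋₊ ≤ ⌊y⌋₊ := Nat.floor_mono hxy
  have h : summatory f y - summatory f x = ∑ n ∈ Finset.Ioc ⌊x⌋₊ ⌊y⌋₊, f n := by
    have hIcc (n : ℕ) : Finset.Icc 1 n = Finset.Ioc 0 n := by
      ext; simp only [Finset.mem_Icc, Finset.mem_Ioc]; omega
    rw [sub_eq_iff_eq_add', summatory, summatory, hIcc, hIcc, Finset.sum_Ioc_consecutive _ (Nat.zero_le _) hfl]
  rw [h]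
  refine (norm_sum_le _ _).trans ((Finset.sum_le_sum fun n _ => hf n).trans ?_)
  simp only [Finset.sum_const, Nat.card_Ioc, nsmul_eq_mul, mul_one]
  rw [Nat.cast_sub hfl]
  linarith [Nat.floor_le (hx.trans hxy), Nat.lt_floor_add_one x]

theorem norm_summatory_le {f : ℕ → ℂ} (hf : ∀ n, ‖f n‖ ≤ 1) {x : ℝ} (hx : 0 ≤ x) :
    ‖summatory f x‖ ≤ x := by
  refine (norm_sum_le _ _).trans ((Finset.sum_le_sum fun n _ => hf n).trans ?_)
  simpa using Nat.floor_le hx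

/-- The Dirichlet series as a Mellin transform of the summatory function. -/
theorem LSeries_eq_mul_mellin {f : ℕ → ℂ} (hf : ∀ n, ‖f n‖ ≤ 1) {s : ℂ} (hs : 1 < s.re) :
    LSeries f s = s * mellin (fun t => summatory f t⁻¹) s := by
  -- Partial summation gives an integral over `(1, ∞)`; it extends to `(0, ∞)` because the summatory
  -- function vanishes below `1`.
  rw [LSeries_eq_mul_integral' f zero_le_one hs, mellin_comp_inv, mellin,
    MeasureTheory.setIntegral_eq_of_subset_of_forall_sdiff_eq_zero (s := Set.Ici (1 : ℝ))
      measurableSet_Ioi (fun x (hx : 1 ≤ x) => zero_lt_one.trans_le hx),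
    MeasureTheory.integral_Ici_eq_integral_Ioi]
  · congr 1
    refine MeasureTheory.setIntegral_congr_fun measurableSet_Ioi fun t _ => ?_
    simp only [summatory, smul_eq_mul]
    rw [mul_comm, neg_add']
  · intro x hx
    rw [summatory_of_lt_one f (not_le.mp hx.2), smul_zero]
  · refine isBigO_of_le _ fun n => ?_
    rw [Real.rpow_one, Real.norm_of_nonneg (Finset.sum_nonneg fun _ _ => norm_nonneg _)]
    refine (Finset.sum_le_sum fun n _ => hf n).trans ?_
    simp

/-! ### A Wiener–Ikehara type theorem -/

section
open MeasureTheory SchwartzMap FourierTransform Topology ContDiff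

/-- With damping `e^(-εu)`, self-adjointness of the Fourier transform turns the smoothed average
near `y` into `∫ Φ(1 + ε + 2πiξ) e(yξ) ψ(ξ) dξ`. Letting `ε → 0` uses only continuity of `Φ` up to
the line and compact support of `ψ`; then Riemann–Lebesgue applies as `y → ∞`. -/
theorem tendsto_integral_mul_fourier {a : ℝ → ℂ} (ha : Measurable a) (hb : ∀ u, ‖a u‖ ≤ 1)
    (h0 : ∀ u < 0, a u = 0) {Φ : ℂ → ℂ} (hΦ : ContinuousOn Φ {s | 1 ≤ s.re})
    (hF : ∀ ε : ℝ, 0 < ε → ∀ ξ : ℝ, 𝓕 (fun u : ℝ => (Real.exp (-ε * u) : ℂ) * a u) ξ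
      = Φ (1 + ε + 2 * Real.pi * ξ * Complex.I))
    (ψ : 𝓢(ℝ, ℂ)) (hψ : HasCompactSupport ψ) :
    Tendsto (fun y : ℝ => ∫ u, a u * 𝓕 (ψ : ℝ → ℂ) (u - y)) atTop (𝓝 0) := by
  have hre (ε ξ : ℝ) : (1 + ε + 2 * Real.pi * ξ * Complex.I : ℂ).re = 1 + ε := by simp
  have hK : Integrable (𝓕 (ψ : ℝ → ℂ)) := by
    rw [← SchwartzMap.fourier_coe]; exact (𝓕 ψ).integrable
  have hint {ε : ℝ} (hε : 0 < ε) : Integrable fun u : ℝ => (Real.exp (-ε * u) : ℂ) * a u := by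
    have h1 : IntegrableOn (fun u : ℝ => Real.exp (-ε * u)) (Set.Ici 0) := by
      rw [integrableOn_Ici_iff_integrableOn_Ioi]
      exact exp_neg_integrableOn_Ioi 0 hε
    refine ((integrable_indicator_iff measurableSet_Ici).mpr h1).mono'
      (by fun_prop) (ae_of_all _ fun u => ?_)
    by_cases hu : u < 0
    · simp [h0 u hu, not_le.mpr hu]
    · rw [Set.indicator_of_mem (show u ∈ Set.Ici 0 from not_lt.mp hu), norm_mul, Complex.norm_real,
        Real.norm_of_nonneg (Real.exp_pos _).le]
      exact mul_le_of_le_one_right (Real.exp_pos _).le (hb u)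
  -- Modulating `ψ` by `e(yξ)` translates its transform by `y`.
  let g : ℝ → ℝ → ℂ := fun y ξ => Real.fourierChar (y * ξ) • ψ ξ
  have hgn (y ξ : ℝ) : ‖g y ξ‖ = ‖ψ ξ‖ := Circle.norm_smul _ _
  have hgc (y : ℝ) : Continuous (g y) := by
    have := ψ.continuous
    have h2 : Continuous fun ξ : ℝ => Real.fourierChar (y * ξ) :=
      Real.continuous_fourierChar.comp (by fun_prop)
    exact h2.smul this
  have hgi (y : ℝ) : Integrable (g y) :=
    ψ.integrable.mono (hgc y).aestronglyMeasurable (ae_of_all _ fun ξ => (hgn y ξ).le)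
  have hgF (y u : ℝ) : 𝓕 (g y) u = 𝓕 (ψ : ℝ → ℂ) (u - y) := by
    rw [Real.fourier_eq, Real.fourier_eq]
    refine integral_congr_ae (ae_of_all _ fun ξ => ?_)
    simp only [g, smul_smul, ← AddChar.map_add_eq_mul]
    congr 2
    simp
    ring
  have hself {ε : ℝ} (hε : 0 < ε) (y : ℝ) :
      ∫ ξ : ℝ, Φ (1 + ε + 2 * Real.pi * ξ * Complex.I) * g y ξ
        = ∫ u : ℝ, ((Real.exp (-ε * u) : ℂ) * a u) * 𝓕 (ψ : ℝ → ℂ) (u - y) := by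
    have := VectorFourier.integral_fourierIntegral_smul_eq_flip (L := innerₗ ℝ)
      Real.continuous_fourierChar continuous_inner (hint hε) (hgi y)
    simp only [smul_eq_mul, flip_innerₗ] at this
    calc _ = _ := ?_
      _ = _ := this
      _ = _ := ?_
    · refine integral_congr_ae (ae_of_all _ fun ξ => ?_)
      simp only
      rw [← hF ε hε ξ]
      rfl
    · refine integral_congr_ae (ae_of_all _ fun u => ?_)
      simp only
      rw [← hgF y u]
      rfl
  have hlim (y : ℝ) : ∫ u, a u * 𝓕 (ψ : ℝ → ℂ) (u - y)
      = ∫ ξ : ℝ, Φ (1 + 2 * Real.pi * ξ * Complex.I) * g y ξ := by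
    have hL : Tendsto (fun ε : ℝ => ∫ u : ℝ, ((Real.exp (-ε * u) : ℂ) * a u)
        * 𝓕 (ψ : ℝ → ℂ) (u - y)) (𝓝[>] 0) (𝓝 (∫ u, a u * 𝓕 (ψ : ℝ → ℂ) (u - y))) := by
      refine tendsto_integral_filter_of_dominated_convergence
        (fun u => ‖𝓕 (ψ : ℝ → ℂ) (u - y)‖) ?_ ?_ (hK.comp_sub_right y).norm ?_
      · refine Eventually.of_forall fun ε => AEStronglyMeasurable.mul (by fun_prop)
          (hK.comp_sub_right y).aestronglyMeasurable
      · filter_upwards [self_mem_nhdsWithin] with ε hε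
        refine ae_of_all _ fun u => ?_
        rw [norm_mul]
        refine mul_le_of_le_one_left (norm_nonneg _) ?_
        by_cases hu : u < 0
        · simp [h0 u hu]
        · rw [norm_mul, Complex.norm_real, Real.norm_of_nonneg (Real.exp_pos _).le]
          refine mul_le_one₀ (Real.exp_le_one_iff.mpr ?_) (norm_nonneg _) (hb u)
          have : (0 : ℝ) < ε := hε
          nlinarith [not_lt.mp hu]
      · refine ae_of_all _ fun u => ?_
        have : Continuous fun ε : ℝ => ((Real.exp (-ε * u) : ℂ) * a u)
            * 𝓕 (ψ : ℝ → ℂ) (u - y) := by fun_prop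
        have h := this.tendsto 0
        simp only [neg_zero, zero_mul, Real.exp_zero, Complex.ofReal_one, one_mul] at h
        exact h.mono_left nhdsWithin_le_nhds
    have hR : Tendsto (fun ε : ℝ => ∫ ξ : ℝ, Φ (1 + ε + 2 * Real.pi * ξ * Complex.I) * g y ξ)
        (𝓝[>] 0) (𝓝 (∫ ξ : ℝ, Φ (1 + 2 * Real.pi * ξ * Complex.I) * g y ξ)) := by
      have hcont : ContinuousOn (fun p : ℝ × ℝ => Φ (1 + p.1 + 2 * Real.pi * p.2 * Complex.I))
          (Set.Ici 0 ×ˢ Set.univ) := by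
        refine hΦ.comp (Continuous.continuousOn (by fun_prop)) fun p hp => ?_
        have : 0 ≤ p.1 := hp.1
        simp only [Set.mem_ofPred_eq, hre]
        linarith
      obtain ⟨M, hM⟩ := (isCompact_Icc (a := (0 : ℝ)) (b := 1)).prod hψ |>.exists_bound_of_continuousOn
        (hcont.mono (Set.prod_mono Set.Icc_subset_Ici_self (Set.subset_univ _)))
      refine tendsto_integral_filter_of_dominated_convergence
        (fun ξ => M * ‖ψ ξ‖) ?_ ?_ (ψ.integrable.norm.const_mul M) ?_
      · filter_upwards [self_mem_nhdsWithin] with ε hε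
        refine (Continuous.mul ?_ (hgc y)).aestronglyMeasurable
        exact hcont.comp_continuous (f := fun ξ : ℝ => ((ε, ξ) : ℝ × ℝ)) (by fun_prop)
          fun ξ => ⟨le_of_lt (Set.mem_Ioi.mp hε), trivial⟩
      · filter_upwards [Ioc_mem_nhdsGT (zero_lt_one' ℝ)] with ε hε
        refine ae_of_all _ fun ξ => ?_
        rw [norm_mul, hgn]
        by_cases hξ : ξ ∈ tsupport ψ
        · exact mul_le_mul_of_nonneg_right (hM (ε, ξ) ⟨⟨hε.1.le, hε.2⟩, hξ⟩) (norm_nonneg _)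
        · simp [image_eq_zero_of_notMem_tsupport hξ]
      · refine ae_of_all _ fun ξ => Tendsto.mul_const _ ?_
        have h := (hcont (0, ξ) ⟨le_refl (0 : ℝ), trivial⟩).tendsto
        simp only [Complex.ofReal_zero, add_zero] at h
        refine h.comp (f := fun ε : ℝ => ((ε, ξ) : ℝ × ℝ)) (tendsto_nhdsWithin_iff.mpr ⟨?_, ?_⟩)
        · exact (Continuous.tendsto' (by fun_prop : Continuous fun ε : ℝ => (ε, ξ)) _ _ rfl).mono_left
            nhdsWithin_le_nhds
        · filter_upwards [self_mem_nhdsWithin] with ε hε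
          exact ⟨le_of_lt (Set.mem_Ioi.mp hε), trivial⟩
    refine tendsto_nhds_unique hL (hR.congr' ?_)
    filter_upwards [self_mem_nhdsWithin] with ε hε
    exact hself hε y
  have hRL := (Real.tendsto_integral_exp_smul_cocompact
    fun ξ : ℝ => Φ (1 + 2 * Real.pi * ξ * Complex.I) * ψ ξ).comp
    (tendsto_neg_atTop_atBot.mono_right atBot_le_cocompact)
  refine hRL.congr fun y => ?_
  rw [hlim y]
  refine integral_congr_ae (ae_of_all _ fun ξ => ?_)
  simp only [g, mul_neg, neg_neg, mul_comm y ξ, mul_smul_comm]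

/-- Dilate a bump: `ψ(ξ) = b(ξ/L)` has transform `L ψ̂₁(Lv)`, whose integral stays `ψ(0) = 1` while
its first absolute moment is divided by `L`. Positivity of the kernel is not required. -/
theorem exists_schwartz_fourier_concentrated {δ : ℝ} (hδ : 0 < δ) :
    ∃ ψ : 𝓢(ℝ, ℂ), HasCompactSupport ψ ∧ ∫ v, 𝓕 (ψ : ℝ → ℂ) v = 1 ∧
      Integrable (fun v => |v| * ‖𝓕 (ψ : ℝ → ℂ) v‖) ∧ ∫ v, |v| * ‖𝓕 (ψ : ℝ → ℂ) v‖ ≤ δ := by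
  let b : ContDiffBump (0 : ℝ) := ⟨1, 2, one_pos, one_lt_two⟩
  have hmoment (ψ : 𝓢(ℝ, ℂ)) : Integrable (fun v => |v| * ‖𝓕 (ψ : ℝ → ℂ) v‖) := by
    have := (𝓕 ψ).integrable_pow_mul volume 1
    simpa [SchwartzMap.fourier_coe] using this
  have hmain (L : ℝ) (hL : 0 < L) : ∃ ψ : 𝓢(ℝ, ℂ), HasCompactSupport ψ ∧ ψ 0 = 1 ∧
      ∀ ξ, ψ ξ = (b (L⁻¹ * ξ) : ℂ) := by
    have h1 : HasCompactSupport fun ξ : ℝ => (b (L⁻¹ * ξ) : ℂ) := by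
      have h2 : HasCompactSupport fun ξ : ℝ => b (L⁻¹ * ξ) :=
        b.hasCompactSupport.comp_homeomorph (Homeomorph.mulLeft₀ L⁻¹ (by positivity))
      exact h2.comp_left (g := fun x : ℝ => (x : ℂ)) Complex.ofReal_zero
    have h3 : ContDiff ℝ ∞ fun ξ : ℝ => b (L⁻¹ * ξ) :=
      b.contDiff.comp (contDiff_const.mul contDiff_id)
    have h2 : ContDiff ℝ ∞ fun ξ : ℝ => (b (L⁻¹ * ξ) : ℂ) := Complex.ofRealCLM.contDiff.comp h3
    refine ⟨h1.toSchwartzMap h2, h1, ?_, fun ξ => rfl⟩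
    simp [b.one_of_mem_closedBall (x := 0) (by simp [b])]
  have hone (ψ : 𝓢(ℝ, ℂ)) (h : ψ 0 = 1) : ∫ v, 𝓕 (ψ : ℝ → ℂ) v = 1 := by
    have hK : Integrable (𝓕 (ψ : ℝ → ℂ)) := by
      rw [← SchwartzMap.fourier_coe]; exact (𝓕 ψ).integrable
    have h1 := congrFun (ψ.continuous.fourierInv_fourier_eq ψ.integrable hK) 0
    rw [← h, ← h1, Real.fourierInv_eq]
    simp
  obtain ⟨ψ₁, hc₁, h₁, he₁⟩ := hmain 1 one_pos
  set M := ∫ v, |v| * ‖𝓕 (ψ₁ : ℝ → ℂ) v‖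
  have hM : 0 ≤ M := integral_nonneg fun v => by positivity
  -- The moment becomes `M / L ≤ δ`; the `+ 1` keeps `L` positive even when `M = 0`.
  set L : ℝ := (M + 1) / δ with hLdef
  have hL : 0 < L := by positivity
  obtain ⟨ψ, hc, h, he⟩ := hmain L hL
  have hscale (v : ℝ) : 𝓕 (ψ : ℝ → ℂ) v = L * 𝓕 (ψ₁ : ℝ → ℂ) (L * v) := by
    have := Measure.integral_comp_mul_left
      (fun η : ℝ => Real.fourierChar (-inner ℝ η (L * v)) • ψ₁ η) L⁻¹
    rw [inv_inv, abs_of_pos hL] at this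
    rw [Real.fourier_eq, Real.fourier_eq, ← Complex.real_smul, ← this]
    refine integral_congr_ae (ae_of_all _ fun ξ => ?_)
    simp only [he, he₁]
    congr 3
    · simp
      field_simp
    · simp
  refine ⟨ψ, hc, hone ψ h, hmoment ψ, ?_⟩
  have h1 : ∫ v, |v| * ‖𝓕 (ψ : ℝ → ℂ) v‖ = L⁻¹ * M := by
    have := Measure.integral_comp_mul_left (fun v : ℝ => |v| * ‖𝓕 (ψ₁ : ℝ → ℂ) v‖) L
    rw [abs_of_pos (inv_pos.mpr hL), smul_eq_mul] at this
    rw [← this]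
    refine integral_congr_ae (ae_of_all _ fun v => ?_)
    simp only [hscale, norm_mul, Complex.norm_real, Real.norm_eq_abs, abs_mul, abs_of_pos hL]
    ring
  rw [h1, hLdef, inv_div, div_mul_eq_mul_div, div_le_iff₀ (by positivity)]
  nlinarith

/-- A Tauberian theorem of Wiener–Ikehara type: if the Dirichlet series of a bounded function
extends continuously to `Re s ≥ 1`, then the function has mean value `0`. -/
theorem summatory_isLittleO {f : ℕ → ℂ} (hf : ∀ n, ‖f n‖ ≤ 1) {H : ℂ → ℂ}
    (hH : ContinuousOn H {s | 1 ≤ s.re}) (h : ∀ s : ℂ, 1 < s.re → LSeries f s = H s) :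
    summatory f =o[atTop] fun x : ℝ => x := by
  -- In logarithmic scale the claim is `a u → 0`. The transform of the damped `a` is `H(s)/s` on the
  -- line `Re s = 1 + ε`.
  set a : ℝ → ℂ := fun u => (Real.exp (-u) : ℂ) * summatory f (Real.exp u) with ha
  have hmeas : Measurable a := by
    have := (measurable_summatory f).comp Real.measurable_exp
    exact Measurable.mul (by fun_prop) this
  have hnorm (u : ℝ) : ‖(Real.exp (-u) : ℂ)‖ = Real.exp (-u) := by
    rw [Complex.norm_real, Real.norm_of_nonneg (Real.exp_pos _).le]
  have hb (u : ℝ) : ‖a u‖ ≤ 1 := by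
    rw [ha, norm_mul, hnorm]
    calc _ ≤ Real.exp (-u) * Real.exp u := by
          gcongr; exact norm_summatory_le hf (Real.exp_pos _).le
      _ = 1 := by rw [← Real.exp_add]; simp
  have h0 (u : ℝ) (hu : u < 0) : a u = 0 := by
    simp [ha, summatory_of_lt_one f (Real.exp_lt_one_iff.mpr hu)]
  have hΦ : ContinuousOn (fun s => H s / s) {s | 1 ≤ s.re} :=
    hH.div continuousOn_id fun s (hs : 1 ≤ s.re) h0 => by simp [show s = 0 from h0] at hs; linarith
  have hF (ε : ℝ) (hε : 0 < ε) (ξ : ℝ) : 𝓕 (fun u : ℝ => (Real.exp (-ε * u) : ℂ) * a u) ξ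
      = H (1 + ε + 2 * Real.pi * ξ * Complex.I) / (1 + ε + 2 * Real.pi * ξ * Complex.I) := by
    set s : ℂ := 1 + ε + 2 * Real.pi * ξ * Complex.I with hs
    have hre : s.re = 1 + ε := by simp [hs]
    have him : s.im / (2 * Real.pi) = ξ := by
      simp [hs]
    have hs0 : s ≠ 0 := fun h0 => by rw [h0] at hre; simp at hre; linarith
    rw [← h s (by linarith), LSeries_eq_mul_mellin hf (by linarith), mul_div_cancel_left₀ _ hs0,
      mellin_eq_fourier, him]
    refine congrArg (fun F : ℝ → ℂ => 𝓕 F ξ) (funext fun u => ?_)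
    simp only [ha]
    rw [hre, Complex.real_smul, ← mul_assoc, ← Complex.ofReal_mul, ← Real.exp_add,
      Real.exp_neg u, inv_inv]
    congr 3
    ring
  -- Slow oscillation, from `‖f n‖ ≤ 1`; it is the Tauberian condition, in place of the usual
  -- monotonicity.
  have hlip (y y' : ℝ) (hy : y ≤ y') : ‖a y' - a y‖ ≤ 2 * (y' - y) + Real.exp (-y') := by
    have e1 : Real.exp y ≤ Real.exp y' := Real.exp_le_exp.mpr hy
    have e2 : Real.exp (-y') ≤ Real.exp (-y) := Real.exp_le_exp.mpr (by linarith)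
    have hdec : a y' - a y
        = (Real.exp (-y') : ℂ) * (summatory f (Real.exp y') - summatory f (Real.exp y))
          - ((Real.exp (-y) - Real.exp (-y') : ℝ) : ℂ) * summatory f (Real.exp y) := by
      simp only [ha]; push_cast; ring
    have e3 : Real.exp (-y') * Real.exp y' = 1 := by rw [← Real.exp_add]; simp
    have e4 : Real.exp (-y) * Real.exp y = 1 := by rw [← Real.exp_add]; simp
    have e5 : 1 - (y' - y) ≤ Real.exp (-y') * Real.exp y := by
      rw [← Real.exp_add]
      linarith [Real.add_one_le_exp (-y' + y)]
    rw [hdec]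
    refine (norm_sub_le _ _).trans ?_
    rw [norm_mul, norm_mul, hnorm, Complex.norm_real, Real.norm_of_nonneg (by linarith)]
    have h1 := mul_le_mul_of_nonneg_left (norm_summatory_sub_le hf (Real.exp_pos y).le e1)
      (Real.exp_pos (-y')).le
    have h2 := mul_le_mul_of_nonneg_left (norm_summatory_le hf (Real.exp_pos y).le)
      (by linarith : 0 ≤ Real.exp (-y) - Real.exp (-y'))
    nlinarith
  have hlip' (y v : ℝ) : ‖a y - a (v + y)‖ ≤ 2 * |v| + Real.exp (-y) := by
    rcases le_total 0 v with hv | hv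
    · rw [norm_sub_rev, abs_of_nonneg hv]
      have := hlip y (v + y) (by linarith)
      have : Real.exp (-(v + y)) ≤ Real.exp (-y) := Real.exp_le_exp.mpr (by linarith)
      linarith
    · rw [abs_of_nonpos hv]
      have := hlip (v + y) y (by linarith)
      linarith
  have ha0 : Tendsto a atTop (𝓝 0) := by
    rw [NormedAddGroup.tendsto_nhds_zero]
    intro δ hδ
    -- Three errors of at most `δ/4` arise: the moment term `2 * (δ/8)`, the `e^(-y)` term, and the
    -- smoothed average itself.
    obtain ⟨ψ, hψ, h1, hi, hle⟩ := exists_schwartz_fourier_concentrated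
      (δ := δ / 8) (by positivity)
    have hK : Integrable (𝓕 (ψ : ℝ → ℂ)) := by
      rw [← SchwartzMap.fourier_coe]; exact (𝓕 ψ).integrable
    have ht := tendsto_integral_mul_fourier hmeas hb h0 hΦ hF ψ hψ
    have he : Tendsto (fun y : ℝ => Real.exp (-y) * ∫ v, ‖𝓕 (ψ : ℝ → ℂ) v‖) atTop (𝓝 0) := by
      simpa using Real.tendsto_exp_neg_atTop_nhds_zero.mul_const (∫ v, ‖𝓕 (ψ : ℝ → ℂ) v‖)
    filter_upwards [(NormedAddGroup.tendsto_nhds_zero.mp ht) (δ / 4) (by positivity),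
      he.eventually_lt_const (show 0 < δ / 4 by positivity)] with y hy1 hy2
    have hshift : ∫ u, a u * 𝓕 (ψ : ℝ → ℂ) (u - y) = ∫ v, a (v + y) * 𝓕 (ψ : ℝ → ℂ) v := by
      rw [← integral_add_right_eq_self _ y]
      simp
    have hi1 : Integrable fun v => a y * 𝓕 (ψ : ℝ → ℂ) v := hK.const_mul _
    have hi2 : Integrable fun v => a (v + y) * 𝓕 (ψ : ℝ → ℂ) v :=
      hK.bdd_mul (hmeas.comp (measurable_add_const y)).aestronglyMeasurable
        (ae_of_all _ fun v => hb (v + y))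
    have hdiff : a y - ∫ u, a u * 𝓕 (ψ : ℝ → ℂ) (u - y)
        = ∫ v, (a y - a (v + y)) * 𝓕 (ψ : ℝ → ℂ) v := by
      simp only [sub_mul]
      rw [hshift, integral_sub hi1 hi2, integral_const_mul, h1, mul_one]
    have hbound : ‖a y - ∫ u, a u * 𝓕 (ψ : ℝ → ℂ) (u - y)‖
        ≤ 2 * (δ / 8) + Real.exp (-y) * ∫ v, ‖𝓕 (ψ : ℝ → ℂ) v‖ := by
      rw [hdiff]
      refine (norm_integral_le_of_norm_le ((hi.const_mul 2).add (hK.norm.const_mul (Real.exp (-y))))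
        (ae_of_all _ fun v => ?_)).trans ?_
      · simp only [Pi.add_apply]
        rw [norm_mul]
        refine (mul_le_mul_of_nonneg_right (hlip' y v) (norm_nonneg _)).trans (le_of_eq ?_)
        ring
      · simp only [Pi.add_apply]
        rw [integral_add (hi.const_mul 2) (hK.norm.const_mul _), integral_const_mul,
          integral_const_mul]
        gcongr
    have htri := norm_add_le (a y - ∫ u, a u * 𝓕 (ψ : ℝ → ℂ) (u - y))
      (∫ u, a u * 𝓕 (ψ : ℝ → ℂ) (u - y))
    rw [sub_add_cancel] at htri
    linarith
  rw [isLittleO_iff]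
  intro δ hδ
  have := (NormedAddGroup.tendsto_nhds_zero.mp (ha0.comp Real.tendsto_log_atTop)) δ hδ
  filter_upwards [this, eventually_gt_atTop 0] with x hx hx0
  simp only [Function.comp_apply, ha, Real.exp_neg, Real.exp_log hx0] at hx
  rw [norm_mul, Complex.norm_real, norm_inv, inv_mul_lt_iff₀ (by simpa using hx0.ne')] at hx
  linarith

end

/-! ### Growth of L(s, χ) in Re s > 0 -/

/-- Sums over complete periods vanish, so whole periods can be stripped until fewer than `q` terms
remain. -/
theorem norm_sum_range_dirichletCharacter_le {q : ℕ} [NeZero q] {χ : DirichletCharacter ℂ q}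
    (hχ : χ ≠ 1) (N : ℕ) : ‖∑ n ∈ Finset.range N, χ n‖ ≤ q := by
  have hper : ∑ n ∈ Finset.range q, χ n = 0 := by
    rw [← MulChar.sum_eq_zero_of_ne_one hχ]
    refine Finset.sum_nbij' (fun n => (n : ZMod q)) ZMod.val (by simp)
      (fun b _ => Finset.mem_range.mpr (ZMod.val_lt b)) (fun n hn => ?_) (by simp) (by simp)
    exact ZMod.val_cast_of_lt (Finset.mem_range.mp hn)
  induction N using Nat.strong_induction_on with
  | _ N ih =>
    rcases lt_or_ge N q with h | h
    · refine (norm_sum_le _ _).trans ((Finset.sum_le_sum fun n _ => χ.norm_le_one _).trans ?_)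
      simpa using h.le
    · obtain ⟨m, rfl⟩ := Nat.exists_eq_add_of_le h
      rw [Finset.sum_range_add, hper, zero_add]
      simp only [Nat.cast_add, ZMod.natCast_self, zero_add]
      exact ih m (by have := NeZero.pos q; omega)

/-- The extra `1` pays for the `n = 0` term, present in the range sum only. -/
theorem norm_summatory_dirichletCharacter_le {q : ℕ} [NeZero q] {χ : DirichletCharacter ℂ q}
    (hχ : χ ≠ 1) (x : ℝ) : ‖summatory (fun n => χ n) x‖ ≤ q + 1 := by
  have h : summatory (fun n => χ n) x = ∑ n ∈ Finset.range (⌊x⌋₊ + 1), χ n - χ (0 : ℕ) := by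
    rw [Finset.sum_range_eq_add_Ico _ (Nat.succ_pos _), summatory]
    simp only [add_sub_cancel_left]
    rfl
  rw [h]
  exact (norm_sub_le _ _).trans (add_le_add (norm_sum_range_dirichletCharacter_le hχ _)
    (χ.norm_le_one _))

section
open MeasureTheory Set Topology

variable {f : ℕ → ℂ} {B : ℝ}

/-- The integrand vanishes for `t > 1`, and `∫₀¹ B t^(Re s - 1) dt = B / Re s`. -/
theorem norm_mellin_summatory_le (hB : ∀ x, ‖summatory f x‖ ≤ B) {s : ℂ} {σ : ℝ}
    (hσ : 0 < σ) (hs : σ ≤ s.re) : ‖mellin (fun t => summatory f t⁻¹) s‖ ≤ B / σ := by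
  have hB0 : 0 ≤ B := (norm_nonneg _).trans (hB 0)
  have hint : IntegrableOn (fun t : ℝ => B * t ^ (s.re - 1)) (Ioc 0 1) := by
    have := intervalIntegral.intervalIntegrable_rpow' (a := 0) (b := 1) (r := s.re - 1)
      (by linarith)
    rw [intervalIntegrable_iff_integrableOn_Ioc_of_le zero_le_one] at this
    exact this.const_mul B
  rw [mellin, setIntegral_eq_of_subset_of_forall_sdiff_eq_zero (s := Ioc (0 : ℝ) 1)
    measurableSet_Ioi (fun x hx => hx.1)]
  · refine (norm_integral_le_of_norm_le hint ((ae_restrict_iff' measurableSet_Ioc).mpr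
      (ae_of_all _ fun t ht => ?_))).trans ?_
    · rw [norm_smul, Complex.norm_cpow_eq_rpow_re_of_pos ht.1, Complex.sub_re, Complex.one_re,
        mul_comm]
      gcongr
      · exact Real.rpow_nonneg ht.1.le _
      · exact hB _
    · rw [integral_const_mul, ← intervalIntegral.integral_of_le zero_le_one,
        integral_rpow (Or.inl (by linarith)), sub_add_cancel, Real.one_rpow,
        Real.zero_rpow (by linarith), sub_zero, mul_one_div]
      gcongr
  · intro t ht
    have h1 : 1 < t := by
      by_contra h
      exact ht.2 ⟨ht.1, not_lt.mp h⟩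
    rw [summatory_of_lt_one f (inv_lt_one_of_one_lt₀ h1), smul_zero]

theorem differentiableOn_mellin_summatory (hB : ∀ x, ‖summatory f x‖ ≤ B) :
    DifferentiableOn ℂ (mellin fun t => summatory f t⁻¹) {s | 0 < s.re} := by
  intro s hs
  refine (mellin_differentiableAt_of_isBigO_rpow (a := s.re + 1) (b := 0) ?_ ?_ (by linarith)
    ?_ hs).differentiableWithinAt
  · refine LocallyIntegrable.locallyIntegrableOn ?_ _
    refine (locallyIntegrable_const B).mono
      ((measurable_summatory f).comp measurable_inv).aestronglyMeasurable
      (ae_of_all _ fun t => (hB _).trans (Real.le_norm_self B))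
  · refine (EventuallyEq.trans_isBigO ?_ (isBigO_zero _ _))
    filter_upwards [eventually_gt_atTop 1] with t ht
    exact summatory_of_lt_one f (inv_lt_one_of_one_lt₀ ht)
  · simp only [neg_zero, Real.rpow_zero]
    exact isBigO_of_le' (c := B) _ fun t => by simpa using hB _

end

/-- Polynomial growth of a non-principal Dirichlet `L`-function in `Re s > 0`. -/
theorem norm_LFunction_le {q : ℕ} [NeZero q] {χ : DirichletCharacter ℂ q} (hχ : χ ≠ 1)
    {s : ℂ} {σ : ℝ} (hσ : 0 < σ) (hs : σ ≤ s.re) :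
    ‖DirichletCharacter.LFunction χ s‖ ≤ (q + 1) / σ * ‖s‖ := by
  have hB := norm_summatory_dirichletCharacter_le hχ
  have hU := isOpen_lt_re 0
  -- Bounded character sums make the Mellin representation holomorphic in `Re s > 0`; the identity
  -- theorem carries it over from `Re s > 1`.
  have heq : Set.EqOn (DirichletCharacter.LFunction χ)
      (fun s => s * mellin (fun t => summatory (fun n => χ n) t⁻¹) s) {s | 0 < s.re} := by
    refine AnalyticOnNhd.eqOn_of_preconnected_of_eventuallyEq
      ((DirichletCharacter.differentiable_LFunction hχ).differentiableOn.analyticOnNhd hU)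
      ((differentiableOn_id.mul (differentiableOn_mellin_summatory hB)).analyticOnNhd hU)
      (convex_halfSpace_re_gt 0).isPreconnected (z₀ := 2) (by simp) ?_
    filter_upwards [(isOpen_lt_re 1).mem_nhds (show (1 : ℝ) < (2 : ℂ).re by norm_num)] with z hz
    rw [DirichletCharacter.LFunction_eq_LSeries χ hz]
    exact LSeries_eq_mul_mellin (fun n => χ.norm_le_one _) hz
  rw [heq (show 0 < s.re by linarith), norm_mul, mul_comm]
  exact mul_le_mul_of_nonneg_right (norm_mellin_summatory_le hB hσ hs) (norm_nonneg _)

/-! ### From bounds on |L| to bounds on log L -/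

section
open Complex.HadamardThreeLines

variable {l : ℂ → ℂ} (hl : DifferentiableOn ℂ l {s | 1 / 2 < s.re}) {A B : ℝ} (hA : 1 ≤ A)
  (hre : ∀ s : ℂ, 1 / 2 < s.re → s.re ≤ 4 → (l s).re ≤ Real.log (A * (|s.im| + 8)))
  (hB : ∀ s : ℂ, 2 ≤ s.re → ‖l s‖ ≤ B)

-- Borel–Carathéodory on the disc of radius `3/2` about `2 + it`: `hre` bounds the real part above,
-- and `hB` bounds the value at the centre. Points with `Re s ≥ 1/2 + δ` stay at distance at least
-- `δ` from the circle, hence the factors `1/δ`.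
include hl hA hre hB in
theorem norm_le_log_of_re_le {δ : ℝ} (hδ : 0 < δ) :
    ∃ C, 1 ≤ C ∧ ∀ s : ℂ, 1 / 2 + δ ≤ s.re → s.re ≤ 2 → ‖l s‖ ≤ C * Real.log (|s.im| + 8) := by
  have hB0 : 0 ≤ B := (norm_nonneg _).trans (hB 2 (by simp))
  -- The shift by `8` keeps the logarithm at least `1`, so constants can be absorbed into it.
  have hlog8 {t : ℝ} : 1 ≤ Real.log (|t| + 8) := by
    rw [Real.le_log_iff_exp_le (by positivity)]
    linarith [Real.exp_one_lt_d9, abs_nonneg t]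
  refine ⟨3 * (Real.log A + 2) / δ + 3 * B / δ + 1, ?_, fun s h1 h2 => ?_⟩
  · have := Real.log_nonneg hA
    have : 0 ≤ 3 * (Real.log A + 2) / δ + 3 * B / δ := by positivity
    linarith
  set c : ℂ := 2 + s.im * Complex.I with hc
  have hcre : c.re = 2 := by simp [hc]
  have hcim : c.im = s.im := by simp [hc]
  have hmem {z : ℂ} (hz : z ∈ Metric.ball (0 : ℂ) (3 / 2)) : 1 / 2 < (c + z).re ∧
      (c + z).re ≤ 4 ∧ |(c + z).im| ≤ |s.im| + 3 / 2 := by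
    rw [mem_ball_zero_iff] at hz
    have h3 := abs_le.mp ((Complex.abs_re_le_norm z).trans hz.le)
    have h4 := abs_lt.mp ((Complex.abs_re_le_norm z).trans_lt hz)
    rw [Complex.add_re, Complex.add_im, hcre, hcim]
    refine ⟨by linarith, by linarith, (abs_add_le _ _).trans ?_⟩
    linarith [Complex.abs_im_le_norm z]
  set L := Real.log (|s.im| + 8) with hL
  have hL1 : 1 ≤ L := hlog8
  have hlogA := Real.log_nonneg hA
  -- On the disc the height is at most `|t| + 3/2`, and `|t| + 3/2 + 8 ≤ (|t| + 8)²`; hence the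
  -- factor `2`.
  set M := Real.log A + 2 * L with hM
  have hM0 : 0 < M := by linarith
  have hz : s - c ∈ Metric.ball (0 : ℂ) (3 / 2) ∧ ‖s - c‖ ≤ 3 / 2 - δ := by
    have : s - c = ((s.re - 2 : ℝ) : ℂ) := by
      apply Complex.ext <;> simp [hc]
    rw [mem_ball_zero_iff, this, Complex.norm_real, Real.norm_eq_abs, abs_of_nonpos (by linarith)]
    constructor <;> linarith
  have hBC := Complex.borelCaratheodory (f := fun z => l (c + z)) (M := M) (R := 3 / 2)
    (z := s - c) hM0
    (hl.comp (by fun_prop) fun z hz => (hmem hz).1) (fun z hz => ?_) (by norm_num) hz.1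
  · simp only [add_sub_cancel, add_zero] at hBC
    refine hBC.trans ?_
    have hn := norm_nonneg (s - c)
    have e1 : 2 * M * ‖s - c‖ / (3 / 2 - ‖s - c‖) ≤ 3 * M / δ := by
      have : 2 * M * ‖s - c‖ ≤ 3 * M := by nlinarith
      exact div_le_div₀ (by positivity) this hδ (by linarith)
    have e2 : ‖l c‖ * (3 / 2 + ‖s - c‖) / (3 / 2 - ‖s - c‖) ≤ 3 * B / δ := by
      have : ‖l c‖ * (3 / 2 + ‖s - c‖) ≤ B * 3 :=
        mul_le_mul (hB c hcre.ge) (by linarith) (by linarith) hB0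
      exact div_le_div₀ (by positivity) (by linarith) hδ (by linarith)
    have e3 : 3 * M / δ ≤ 3 * (Real.log A + 2) / δ * L := by
      rw [div_mul_eq_mul_div]
      have : 3 * M ≤ 3 * (Real.log A + 2) * L := by nlinarith
      gcongr
    have e4 : 3 * B / δ ≤ 3 * B / δ * L := le_mul_of_one_le_right (by positivity) hL1
    nlinarith
  · obtain ⟨m1, m2, m3⟩ := hmem hz
    refine (hre _ m1 m2).trans ?_
    have hpos : 0 < |s.im| + 8 := by positivity
    have h4 : 2 * L = Real.log ((|s.im| + 8) ^ 2) := by rw [Real.log_pow]; push_cast; ring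
    rw [hM, h4, ← Real.log_mul (by positivity) (by positivity)]
    refine Real.log_le_log (by positivity) ?_
    gcongr
    nlinarith [abs_nonneg s.im]

/-- Used to localise the three lines argument at height `t₀`: moving away costs at most `|t - t₀|`
in the logarithm, which the Gaussian absorbs. -/
theorem log_add_mul_exp_neg_sq_le (t t₀ : ℝ) :
    Real.log (|t| + 8) * Real.exp (-(t - t₀) ^ 2) ≤ 2 * Real.log (|t₀| + 8) := by
  have hL : 1 ≤ Real.log (|t₀| + 8) := by
    rw [Real.le_log_iff_exp_le (by positivity)]
    linarith [Real.exp_one_lt_d9, abs_nonneg t₀]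
  set w := |t - t₀| with hw
  have hw0 : 0 ≤ w := abs_nonneg _
  have h1 : Real.log (|t| + 8) ≤ Real.log (|t₀| + 8) + w := by
    have : |t| + 8 ≤ (|t₀| + 8) * Real.exp w := by
      have h2 := Real.add_one_le_exp w
      have h3 : |t| ≤ |t₀| + w := by
        have := abs_add_le t₀ (t - t₀)
        rwa [add_sub_cancel] at this
      nlinarith [abs_nonneg t₀]
    refine (Real.log_le_log (by positivity) this).trans ?_
    rw [Real.log_mul (by positivity) (Real.exp_pos _).ne', Real.log_exp]
  have hsq : (t - t₀) ^ 2 = w ^ 2 := (sq_abs _).symm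
  have h4 : (1 + w) * Real.exp (-w ^ 2) ≤ 2 := by
    have h5 := Real.add_one_le_exp (w ^ 2)
    have h6 : Real.exp (w ^ 2) * Real.exp (-w ^ 2) = 1 := by rw [← Real.exp_add]; simp
    have h7 : 1 + w ≤ 2 * Real.exp (w ^ 2) := by nlinarith [sq_nonneg (w - 1)]
    nlinarith [Real.exp_pos (-w ^ 2)]
  rw [hsq]
  calc _ ≤ (Real.log (|t₀| + 8) * (1 + w)) * Real.exp (-w ^ 2) := by
        gcongr; nlinarith
    _ ≤ _ := by nlinarith

include hl hA hre hB in
/-- A branch of `log L(s)` is `o(log |t|)` uniformly in `Re s ≥ 1/2 + 2δ`. -/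
theorem norm_le_mul_log_add {δ η : ℝ} (hδ : 0 < δ) (hη : 0 < η) :
    ∃ C, ∀ s : ℂ, 1 / 2 + 2 * δ ≤ s.re → ‖l s‖ ≤ η * Real.log (|s.im| + 8) + C := by
  have hB0 : 0 ≤ B := (norm_nonneg _).trans (hB 2 (by simp))
  have hlog8 (t : ℝ) : 1 ≤ Real.log (|t| + 8) := by
    rw [Real.le_log_iff_exp_le (by positivity)]
    linarith [Real.exp_one_lt_d9, abs_nonneg t]
  obtain ⟨C, hC1, hC⟩ := norm_le_log_of_re_le hl hA hre hB hδ
  -- A lower bound for the interpolation weight `τ` below, whose numerator is at least `δ` and whose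
  -- denominator is at most `3/2`.
  set θ : ℝ := min (1 / 2) (δ / (3 / 2)) with hθ
  have hθ0 : 0 < θ := by positivity
  have hθ1 : θ ≤ 1 / 2 := min_le_left _ _
  set K₁ : ℝ := 2 * C * Real.exp 4 with hK₁
  set K₂ : ℝ := B * Real.exp 4 + 1 with hK₂
  have hexp4 : 1 ≤ Real.exp 4 := Real.one_le_exp (by norm_num)
  have hK₁1 : 1 ≤ K₁ := by nlinarith
  have hK₂1 : 1 ≤ K₂ := by have : 0 ≤ B * Real.exp 4 := by positivity
                           linarith
  -- Three lines between `Re = 1/2 + δ`, with bound `O(log)`, and `Re = 2`, with bound `O(1)`: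
  -- inside, the power of the logarithm drops to `1 - θ < 1`.
  have hstrip (s : ℂ) (h1 : 1 / 2 + 2 * δ ≤ s.re) (h2 : s.re ≤ 2) :
      ‖l s‖ ≤ (K₁ * Real.log (|s.im| + 8)) ^ (1 - θ) * K₂ := by
    set a : ℝ := K₁ * Real.log (|s.im| + 8) with ha
    have ha1 : 1 ≤ a := one_le_mul_of_one_le_of_one_le hK₁1 (hlog8 _)
    -- The twist equals `1` at `z = s` and makes `g` bounded on the strip; its growth in the real
    -- direction is at most `exp 4`.
    let g : ℂ → ℂ := fun z => l z * Complex.exp ((z - s) ^ 2)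
    have hg (z : ℂ) : ‖g z‖ = ‖l z‖ *
        (Real.exp ((z.re - s.re) ^ 2) * Real.exp (-(z.im - s.im) ^ 2)) := by
      rw [norm_mul, Complex.norm_exp, ← Real.exp_add]
      congr 2
      simp [sq]
      ring
    have hexp {z : ℂ} (h3 : 1 / 2 + δ ≤ z.re) (h4 : z.re ≤ 2) :
        Real.exp ((z.re - s.re) ^ 2) ≤ Real.exp 4 := by
      refine Real.exp_le_exp.mpr ?_
      nlinarith
    have hga {z : ℂ} (h3 : 1 / 2 + δ ≤ z.re) (h4 : z.re ≤ 2) : ‖g z‖ ≤ a := by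
      rw [hg]
      calc _ ≤ (C * Real.log (|z.im| + 8)) * (Real.exp 4 * Real.exp (-(z.im - s.im) ^ 2)) := by
            have hz := hC z h3 h4
            exact mul_le_mul hz (mul_le_mul_of_nonneg_right (hexp h3 h4) (Real.exp_pos _).le)
              (by positivity) ((norm_nonneg _).trans hz)
        _ = (C * Real.exp 4) * (Real.log (|z.im| + 8) * Real.exp (-(z.im - s.im) ^ 2)) := by ring
        _ ≤ (C * Real.exp 4) * (2 * Real.log (|s.im| + 8)) := by
            exact mul_le_mul_of_nonneg_left (log_add_mul_exp_neg_sq_le _ _) (by positivity)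
        _ = a := by rw [ha, hK₁]; ring
    have hl2 : 1 / 2 + δ < 2 := by linarith
    have hd : DifferentiableOn ℂ g {z | 1 / 2 < z.re} := hl.mul (by fun_prop)
    have hclos : closure (verticalStrip (1 / 2 + δ) 2) ⊆ {z : ℂ | 1 / 2 < z.re} := by
      refine (closure_mono (t := {z : ℂ | 1 / 2 + δ ≤ z.re}) fun z hz => hz.1.le).trans ?_
      rw [(isClosed_le continuous_const Complex.continuous_re).closure_eq]
      intro z hz
      simp only [Set.mem_ofPred_eq] at hz ⊢
      linarith
    have hH := norm_le_interp_of_mem_verticalClosedStrip' (f := g) (z := s) (a := a) (b := K₂)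
      hl2 ⟨by linarith, h2⟩ (hd.mono hclos).diffContOnCl
      ⟨a, by rintro _ ⟨z, hz, rfl⟩; exact hga hz.1 hz.2⟩
      (fun z hz => by
        have : z.re = 1 / 2 + δ := hz
        exact hga this.ge (by linarith))
      (fun z hz => by
        have hz2 : z.re = 2 := hz
        rw [hg]
        have e1 : Real.exp (-(z.im - s.im) ^ 2) ≤ 1 :=
          Real.exp_le_one_iff.mpr (by nlinarith [sq_nonneg (z.im - s.im)])
        calc _ ≤ B * (Real.exp 4 * 1) := by
              exact mul_le_mul (hB z hz2.ge) (mul_le_mul (hexp (by linarith) hz2.le) e1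
                (Real.exp_pos _).le (Real.exp_pos _).le) (by positivity) hB0
          _ ≤ K₂ := by rw [hK₂]; linarith)
    have hgs : ‖g s‖ = ‖l s‖ := by rw [hg]; simp
    rw [hgs] at hH
    set τ := (s.re - (1 / 2 + δ)) / (2 - (1 / 2 + δ)) with hτ
    have hτ0 : θ ≤ τ := by
      refine (min_le_right _ _).trans ?_
      exact div_le_div₀ (by linarith) (by linarith) (by linarith) (by linarith)
    have hτ1 : τ ≤ 1 := by
      rw [hτ, div_le_one (by linarith)]
      linarith
    refine hH.trans ?_
    refine mul_le_mul (Real.rpow_le_rpow_of_exponent_le ha1 (by linarith)) ?_ (by positivity)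
      (by positivity)
    · calc K₂ ^ τ ≤ K₂ ^ (1 : ℝ) := Real.rpow_le_rpow_of_exponent_le hK₂1 hτ1
        _ = K₂ := Real.rpow_one _
  -- A sublinear power lies below any line of positive slope up to a constant; the slope `η / K₁`
  -- cancels the factor `K₁` in `hstrip`.
  have hsmall : ∃ D, ∀ x : ℝ, 1 ≤ x → x ^ (1 - θ) * K₂ ≤ η / K₁ * x + D := by
    obtain ⟨X, hX⟩ := ((tendsto_rpow_neg_atTop hθ0).eventually_le_const
      (show 0 < η / K₁ / K₂ by positivity)).exists_forall_of_atTop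
    refine ⟨(max X 1) ^ (1 - θ) * K₂, fun x hx => ?_⟩
    rcases le_total X x with h | h
    · have h3 := hX x h
      calc x ^ (1 - θ) * K₂ = x * x ^ (-θ) * K₂ := by
            rw [sub_eq_add_neg, Real.rpow_add (by linarith), Real.rpow_one]
        _ ≤ x * (η / K₁ / K₂) * K₂ := by gcongr
        _ = η / K₁ * x := by field_simp
        _ ≤ _ := le_add_of_nonneg_right (by positivity)
    · have : x ^ (1 - θ) * K₂ ≤ (max X 1) ^ (1 - θ) * K₂ := by
        gcongr
        · linarith
        · exact h.trans (le_max_left _ _)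
      have : 0 ≤ η / K₁ * x := by positivity
      linarith
  obtain ⟨D, hD⟩ := hsmall
  have hD0 : 0 ≤ |D| := abs_nonneg D
  refine ⟨B + |D|, fun s hs => ?_⟩
  have hL := hlog8 s.im
  rcases le_total s.re 2 with h | h
  · refine (hstrip s hs h).trans ((hD _ (one_le_mul_of_one_le_of_one_le hK₁1 hL)).trans ?_)
    have : η / K₁ * (K₁ * Real.log (|s.im| + 8)) = η * Real.log (|s.im| + 8) := by field_simp
    rw [this]
    linarith [le_abs_self D]
  · have : 0 ≤ η * Real.log (|s.im| + 8) := by positivity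
    linarith [hB s h]

end

/-! ### Contour shifts and a smoothed Perron formula -/

section
open MeasureTheory Set Topology

theorem one_add_abs_im_le {s : ℂ} (hs : 1 / 2 ≤ s.re) : 1 + |s.im| ≤ 3 * ‖s‖ := by
  have h1 := Complex.abs_im_le_norm s
  have h2 := Complex.re_le_norm s
  linarith

theorem one_add_abs_im_le_norm_add_one {s : ℂ} (hs : 1 / 2 ≤ s.re) :
    1 + |s.im| ≤ 3 * ‖s + 1‖ := by
  have := one_add_abs_im_le (s := s + 1) (by simp; linarith)
  simpa using this

theorem integrable_one_add_abs_rpow {p : ℝ} (hp : 1 < p) :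
    Integrable fun t : ℝ => (1 + |t|) ^ (-p) := by
  have := integrable_one_add_norm (E := ℝ) (μ := volume) (r := p) (by simpa using hp)
  simpa using this

theorem re_add_mul_I (σ t : ℝ) : ((σ : ℂ) + t * Complex.I).re = σ := by simp
theorem im_add_mul_I (σ t : ℝ) : ((σ : ℂ) + t * Complex.I).im = t := by simp

theorem norm_inv_mul_add_one_le {s : ℂ} (hs : 1 / 2 ≤ s.re) :
    ‖1 / (s * (s + 1))‖ ≤ 9 * (1 + |s.im|) ^ (-2 : ℝ) := by
  have h1 := one_add_abs_im_le hs
  have h2 := one_add_abs_im_le_norm_add_one hs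
  have h0 : 0 < 1 + |s.im| := by positivity
  have h3 : (1 + |s.im|) ^ 2 ≤ 9 * (‖s‖ * ‖s + 1‖) := by nlinarith
  have hn1 : 0 < ‖s‖ := by linarith
  have hn2 : 0 < ‖s + 1‖ := by linarith
  rw [norm_div, norm_one, norm_mul, Real.rpow_neg h0.le, Real.rpow_two, ← div_eq_mul_inv,
    div_le_div_iff₀ (by positivity) (by positivity), one_mul]
  exact h3

/-- Shifting a vertical line of integration. -/
theorem integral_vertical_eq {g : ℂ → ℂ} {σ c K p : ℝ} (hσc : σ ≤ c) (hp : 1 < p)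
    (hg : ∀ s : ℂ, σ ≤ s.re → s.re ≤ c → DifferentiableAt ℂ g s)
    (hK : ∀ s : ℂ, σ ≤ s.re → s.re ≤ c → ‖g s‖ ≤ K * (1 + |s.im|) ^ (-p)) :
    Integrable (fun t : ℝ => g (σ + t * Complex.I)) ∧
    Integrable (fun t : ℝ => g (c + t * Complex.I)) ∧
      ∫ t : ℝ, g (σ + t * Complex.I) = ∫ t : ℝ, g (c + t * Complex.I) := by
  have hint (b : ℝ) (h1 : σ ≤ b) (h2 : b ≤ c) : Integrable fun t : ℝ => g (b + t * Complex.I) := by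
    refine ((integrable_one_add_abs_rpow hp).const_mul K).mono'
      (Continuous.aestronglyMeasurable ?_) (ae_of_all _ fun t => ?_)
    · refine continuous_iff_continuousAt.mpr fun t => ?_
      exact ContinuousAt.comp (f := fun t : ℝ => (b : ℂ) + t * Complex.I)
        (hg _ (by simpa using h1) (by simpa using h2)).continuousAt (by fun_prop)
    · have := hK (b + t * Complex.I) (by simpa using h1) (by simpa using h2)
      rwa [im_add_mul_I] at this
  have hi1 := hint σ le_rfl hσc
  have hi2 := hint c hσc le_rfl
  refine ⟨hi1, hi2, ?_⟩
  -- Cauchy's theorem on the rectangle of heights `±T`; the horizontal sides vanish as `T → ∞`.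
  have hT (T : ℝ) : (∫ x : ℝ in σ..c, g (x + (-T : ℝ) * Complex.I))
      - (∫ x : ℝ in σ..c, g (x + T * Complex.I)) + Complex.I • (∫ y : ℝ in -T..T, g (c + y * Complex.I))
      - Complex.I • (∫ y : ℝ in -T..T, g (σ + y * Complex.I)) = 0 := by
    have := Complex.integral_boundary_rect_eq_zero_of_differentiableOn g
      (σ + (-T : ℝ) * Complex.I) (c + T * Complex.I) (fun s hs => by
        have h1 : s.re ∈ Set.uIcc σ c := by simpa using hs.1
        rw [uIcc_of_le hσc] at h1
        exact (hg s h1.1 h1.2).differentiableWithinAt)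
    simpa only [re_add_mul_I, im_add_mul_I] using this
  have hdecay : Tendsto (fun T : ℝ => (c - σ) * (K * (1 + |T|) ^ (-p))) atTop (𝓝 0) := by
    have h1 : Tendsto (fun T : ℝ => (1 + |T|)) atTop atTop :=
      tendsto_atTop_add_const_left _ _ tendsto_abs_atTop_atTop
    have h2 := ((tendsto_rpow_neg_atTop (by linarith : 0 < p)).comp h1).const_mul K |>.const_mul (c - σ)
    simpa using h2
  have hhor (ε : ℝ) (hε : |ε| = 1) :
      Tendsto (fun T : ℝ => ∫ x : ℝ in σ..c, g (x + (ε * T : ℝ) * Complex.I)) atTop (𝓝 0) := by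
    refine squeeze_zero_norm (fun T => ?_) hdecay
    have := intervalIntegral.norm_integral_le_of_norm_le_const (a := σ) (b := c)
      (f := fun x : ℝ => g (x + (ε * T : ℝ) * Complex.I)) (C := K * (1 + |T|) ^ (-p)) (fun x hx => by
        rw [uIoc_of_le hσc] at hx
        have := hK (x + (ε * T : ℝ) * Complex.I) (by simpa using hx.1.le) (by simpa using hx.2)
        rwa [im_add_mul_I, abs_mul, hε, one_mul] at this)
    rwa [abs_of_nonneg (sub_nonneg.mpr hσc), mul_comm _ (c - σ)] at this
  have hv1 := intervalIntegral_tendsto_integral hi1 tendsto_neg_atTop_atBot tendsto_id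
  have hv2 := intervalIntegral_tendsto_integral hi2 tendsto_neg_atTop_atBot tendsto_id
  have hlim := (((hhor (-1) (by simp)).sub (hhor 1 (by simp))).add (hv2.const_smul Complex.I)).sub
    (hv1.const_smul Complex.I)
  have hzero := hlim.congr' (Eventually.of_forall fun T => by
    have := hT T
    simp only [neg_mul, one_mul, id] at this ⊢
    exact this) |> tendsto_nhds_unique tendsto_const_nhds
  simp only [sub_zero, zero_add, smul_eq_mul, ← mul_sub] at hzero
  have := (mul_eq_zero.mp hzero.symm).resolve_left Complex.I_ne_zero
  exact (sub_eq_zero.mp this).symm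

/-- Mellin inversion: `max 0 (1 - u)` has transform `1/s - 1/(s+1) = 1/(s(s+1))`, integrable on
vertical lines. -/
theorem perron_kernel {y : ℝ} (hy : 0 < y) {c : ℝ} (hc : 1 / 2 ≤ c) :
    ∫ t : ℝ, (y : ℂ) ^ (-(c + t * Complex.I)) *
      (1 / ((c + t * Complex.I) * (c + t * Complex.I + 1)))
      = 2 * Real.pi * (max 0 (1 - y) : ℝ) := by
  let k : ℝ → ℂ := fun u => (max 0 (1 - u) : ℝ)
  have hk : ∀ s : ℂ, 0 < s.re → HasMellin k s (1 / (s * (s + 1))) := by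
    intro s hs
    have h1 := hasMellin_one_Ioc hs
    have h2 := hasMellin_cpow_Ioc 1 (s := s) (by simp; linarith)
    have h3 := hasMellin_sub h1.1 h2.1
    rw [h1.2, h2.2] at h3
    have hs0 : s ≠ 0 := fun h => by simp [h] at hs
    have hs1 : s + 1 ≠ 0 := fun h => by
      have := congrArg Complex.re h; simp at this; linarith
    have heq : 1 / s - 1 / (s + 1) = 1 / (s * (s + 1)) := by field_simp; ring
    rw [heq] at h3
    have hfun : ∀ t ∈ Ioi (0 : ℝ), (t : ℂ) ^ (s - 1) • (indicator (Ioc 0 1) (fun _ => 1 : ℝ → ℂ) t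
        - indicator (Ioc 0 1) (fun t => (t : ℂ) ^ (1 : ℂ) : ℝ → ℂ) t) = (t : ℂ) ^ (s - 1) • k t := by
      intro t ht
      by_cases h : t ≤ 1
      · have hm : t ∈ Ioc (0 : ℝ) 1 := ⟨ht, h⟩
        simp [k, hm, max_eq_right (sub_nonneg.mpr h)]
      · have hm : t ∉ Ioc (0 : ℝ) 1 := fun hm => h hm.2
        simp [k, hm, max_eq_left (sub_nonpos.mpr (not_le.mp h).le)]
    refine ⟨h3.1.congr_fun hfun measurableSet_Ioi, ?_⟩
    rw [← h3.2, mellin, mellin]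
    exact (setIntegral_congr_fun measurableSet_Ioi hfun).symm
  have hre (t : ℝ) : 0 < ((c : ℂ) + t * Complex.I).re := by simp; linarith
  have hm (t : ℝ) : mellin k (c + t * Complex.I)
      = 1 / ((c + t * Complex.I) * (c + t * Complex.I + 1)) := (hk _ (hre t)).2
  have hv : Complex.VerticalIntegrable (mellin k) c volume := by
    unfold Complex.VerticalIntegrable
    simp only [hm]
    refine ((integrable_one_add_abs_rpow (by norm_num : (1 : ℝ) < 2)).const_mul 9).mono'
      (Continuous.aestronglyMeasurable ?_) (ae_of_all _ fun t => ?_)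
    · refine Continuous.div₀ continuous_const (by fun_prop) fun t => mul_ne_zero ?_ ?_
      · intro h; have := hre t; simp [h] at this
      · intro h
        have h2 := congrArg Complex.re h
        simp at h2; linarith
    · have := norm_inv_mul_add_one_le (s := c + t * Complex.I) (by simpa using hc)
      rwa [im_add_mul_I] at this
  have hmain := mellinInv_mellin_eq c k hy (hk c (by simp; linarith)).1 hv (by fun_prop)
  rw [mellinInv] at hmain
  simp only [hm, smul_eq_mul] at hmain
  have hpi : (2 * Real.pi : ℂ) ≠ 0 := by
    exact_mod_cast (mul_pos two_pos Real.pi_pos).ne'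
  change _ = 2 * Real.pi * k y
  rw [← hmain]
  rw [Complex.real_smul, ← mul_assoc]
  push_cast
  rw [mul_one_div_cancel hpi, one_mul]

variable {f : ℕ → ℂ} {H : ℂ → ℂ}

/-- The smoothed sum `∑_{n ≤ x} f(n) (x - n)`. -/
noncomputable def rieszSum (f : ℕ → ℂ) (x : ℝ) : ℂ :=
  ∑ n ∈ Finset.Icc 1 ⌊x⌋₊, f n * ((x - n : ℝ) : ℂ)

/-- Integrate the Dirichlet series termwise on `Re s = 2`. The kernel at `y = n/x`, times `x`,
yields `max 0 (x - n)`; the majorant `n^(-2) (1 + |t|)^(-2)` justifies the exchange. -/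
theorem rieszSum_eq_integral (hf : ∀ n, ‖f n‖ ≤ 1) (hH : ∀ s : ℂ, 1 < s.re → LSeries f s = H s)
    {x : ℝ} (hx : 0 < x) : 2 * Real.pi * rieszSum f x
      = ∫ t : ℝ, H ((2 : ℝ) + t * Complex.I) * ((x : ℂ) ^ ((2 : ℝ) + t * Complex.I + 1) *
        (1 / (((2 : ℝ) + t * Complex.I) * ((2 : ℝ) + t * Complex.I + 1)))) := by
  set L : ℝ → ℂ := fun t => (2 : ℝ) + t * Complex.I with hL
  have hLre (t : ℝ) : (L t).re = 2 := re_add_mul_I 2 t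
  have hLim (t : ℝ) : (L t).im = t := im_add_mul_I 2 t
  have hx0 : (x : ℂ) ≠ 0 := by exact_mod_cast hx.ne'
  let F : ℕ → ℝ → ℂ := fun n t => LSeries.term f (L t) n *
    ((x : ℂ) ^ (L t + 1) * (1 / (L t * (L t + 1))))
  have hcL : Continuous L := by fun_prop
  have hbound (n : ℕ) (t : ℝ) : ‖F n t‖ ≤ (9 * x ^ (3 : ℝ)) * (n : ℝ) ^ (-2 : ℝ)
      * (1 + |t|) ^ (-2 : ℝ) := by
    have h1 : ‖LSeries.term f (L t) n‖ ≤ (n : ℝ) ^ (-2 : ℝ) := by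
      rcases Nat.eq_zero_or_pos n with rfl | hn
      · simp
      · rw [LSeries.term_of_ne_zero hn.ne', norm_div, Complex.norm_natCast_cpow_of_pos hn, hLre,
          Real.rpow_neg (by positivity), ← one_div]
        gcongr
        exact hf n
    have h2 : ‖(x : ℂ) ^ (L t + 1)‖ = x ^ (3 : ℝ) := by
      rw [Complex.norm_cpow_eq_rpow_re_of_pos hx, Complex.add_re, hLre]
      norm_num
    have h3 := norm_inv_mul_add_one_le (s := L t) (by rw [hLre]; norm_num)
    rw [hLim] at h3
    rw [norm_mul, norm_mul, h2]
    calc _ ≤ (n : ℝ) ^ (-2 : ℝ) * (x ^ (3 : ℝ) * (9 * (1 + |t|) ^ (-2 : ℝ))) := by gcongr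
      _ = _ := by ring
  have hdec := integrable_one_add_abs_rpow (by norm_num : (1 : ℝ) < 2)
  have hFint (n : ℕ) : Integrable (F n) := by
    refine (hdec.const_mul ((9 * x ^ (3 : ℝ)) * (n : ℝ) ^ (-2 : ℝ))).mono'
      (Continuous.aestronglyMeasurable ?_) (ae_of_all _ (hbound n))
    refine Continuous.mul ?_ (Continuous.mul ?_ ?_)
    · rcases Nat.eq_zero_or_pos n with rfl | hn
      · simp only [LSeries.term_zero]; fun_prop
      · have hn0 : (n : ℂ) ≠ 0 := by exact_mod_cast hn.ne'
        simp only [LSeries.term_of_ne_zero hn.ne']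
        exact continuous_const.div₀ (hcL.const_cpow (Or.inl hn0))
          fun t => by simp [Complex.cpow_eq_zero_iff, hn0]
    · exact (hcL.add continuous_const).const_cpow (Or.inl hx0)
    · refine continuous_const.div₀ (by fun_prop) fun t => mul_ne_zero ?_ ?_
      · intro h; have := hLre t; simp [h] at this
      · intro h
        have h2 := congrArg Complex.re h
        rw [Complex.add_re, hLre] at h2
        norm_num at h2
  have hsum : Summable fun n => ∫ t, ‖F n t‖ := by
    refine Summable.of_nonneg_of_le (fun n => integral_nonneg fun t => norm_nonneg _) (fun n => ?_)
      (((Real.summable_nat_rpow.mpr (by norm_num : (-2 : ℝ) < -1)).mul_left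
        (9 * x ^ (3 : ℝ))).mul_right (∫ t : ℝ, (1 + |t|) ^ (-2 : ℝ)))
    rw [← integral_const_mul]
    exact integral_mono (hFint n).norm (hdec.const_mul _) (hbound n)
  have hval (n : ℕ) : ∫ t, F n t = if n ∈ Finset.Icc 1 ⌊x⌋₊ then
      2 * Real.pi * (f n * ((x - n : ℝ) : ℂ)) else 0 := by
    rcases Nat.eq_zero_or_pos n with rfl | hn
    · simp [F]
    have hnpos : (0 : ℝ) < n := by exact_mod_cast hn
    have hker := perron_kernel (y := n / x) (by positivity) (c := 2) (by norm_num)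
    have h1 : ∫ t, F n t = f n * x * ∫ t : ℝ, (((n / x : ℝ) : ℂ) ^ (-(((2 : ℝ) : ℂ) + t * Complex.I)) *
      (1 / ((((2 : ℝ) : ℂ) + t * Complex.I) * (((2 : ℝ) : ℂ) + t * Complex.I + 1)))) := by
      rw [← integral_const_mul]
      refine integral_congr_ae (ae_of_all _ fun t => ?_)
      simp only [F, LSeries.term_of_ne_zero hn.ne']
      have h2 : ((n / x : ℝ) : ℂ) ^ (-(L t)) = (x : ℂ) ^ (L t) / (n : ℂ) ^ (L t) := by
        rw [div_eq_mul_inv, Complex.ofReal_mul, Complex.mul_cpow_ofReal_nonneg hnpos.le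
          (inv_pos.mpr hx).le, Complex.ofReal_natCast, Complex.ofReal_inv, Complex.inv_cpow _ _ (by
            rw [Complex.arg_ofReal_of_nonneg hx.le]; exact Real.pi_pos.ne), Complex.cpow_neg,
          Complex.cpow_neg, inv_inv]
        ring
      change _ = f n * x * (((n / x : ℝ) : ℂ) ^ (-(L t)) * (1 / (L t * (L t + 1))))
      rw [h2, Complex.cpow_add _ _ hx0, Complex.cpow_one]
      ring
    rw [h1, hker]
    split_ifs with hmem
    · have hnx : (n : ℝ) ≤ x := (Nat.le_floor_iff hx.le).mp (Finset.mem_Icc.mp hmem).2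
      rw [max_eq_right (by rw [sub_nonneg, div_le_one hx]; exact hnx)]
      push_cast
      field_simp
    · have hnx : x ≤ n := by
        by_contra h
        exact hmem (Finset.mem_Icc.mpr ⟨hn, Nat.le_floor (not_le.mp h).le⟩)
      rw [max_eq_left (by rw [sub_nonpos, one_le_div hx]; exact hnx)]
      simp
  have hS := (hasSum_integral_of_summable_integral_norm hFint hsum).tsum_eq
  simp only [hval] at hS
  rw [tsum_eq_sum (s := Finset.Icc 1 ⌊x⌋₊) (fun n hn => if_neg hn)] at hS
  rw [rieszSum, Finset.mul_sum, ← Finset.sum_congr rfl fun n hn => if_pos hn, hS]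
  refine integral_congr_ae (ae_of_all _ fun t => ?_)
  simp only [F, tsum_mul_right]
  rw [← hH (L t) (by rw [hLre]; norm_num)]
  rfl

/-- Recovers the sharp cutoff: each `n ≤ x` contributes exactly `h * f n` to the difference, and the
at most `h + 1` integers in `(x, x + h]` contribute at most `h` each. -/
theorem norm_rieszSum_sub_le (hf : ∀ n, ‖f n‖ ≤ 1) {x h : ℝ} (hx : 0 ≤ x) (hh : 0 ≤ h) :
    ‖rieszSum f (x + h) - rieszSum f x - h * summatory f x‖ ≤ h * (h + 1) := by
  have hfl : ⌊x⌋₊ ≤ ⌊x + h⌋₊ := Nat.floor_mono (by linarith)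
  have hIcc (n : ℕ) : Finset.Icc 1 n = Finset.Ioc 0 n := by
    ext; simp only [Finset.mem_Icc, Finset.mem_Ioc]; omega
  have h1 : rieszSum f (x + h) - rieszSum f x - h * summatory f x
      = ∑ n ∈ Finset.Ioc ⌊x⌋₊ ⌊x + h⌋₊, f n * ((x + h - n : ℝ) : ℂ) := by
    rw [rieszSum, rieszSum, summatory, hIcc, hIcc,
      ← Finset.sum_Ioc_consecutive _ (Nat.zero_le _) hfl, Finset.mul_sum, sub_sub,
      ← Finset.sum_add_distrib, sub_eq_iff_eq_add', add_left_inj]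
    refine Finset.sum_congr rfl fun n _ => ?_
    push_cast
    ring
  rw [h1]
  have h2 : ∀ n ∈ Finset.Ioc ⌊x⌋₊ ⌊x + h⌋₊, ‖f n * ((x + h - n : ℝ) : ℂ)‖ ≤ h := by
    intro n hn
    rw [Finset.mem_Ioc] at hn
    have h3 : x < n := (Nat.floor_lt hx).mp hn.1
    have h4 : (n : ℝ) ≤ x + h := (Nat.le_floor_iff (by linarith)).mp hn.2
    rw [norm_mul, Complex.norm_real, Real.norm_of_nonneg (by linarith)]
    calc _ ≤ 1 * (x + h - n) := mul_le_mul_of_nonneg_right (hf n) (by linarith)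
      _ ≤ h := by linarith
  refine (norm_sum_le _ _).trans ((Finset.sum_le_sum h2).trans ?_)
  rw [Finset.sum_const, Nat.card_Ioc, nsmul_eq_mul, Nat.cast_sub hfl, mul_comm]
  gcongr
  linarith [Nat.floor_le (by linarith : 0 ≤ x + h), Nat.lt_floor_add_one x]

end

/-! ### Square-root cancellation from growth bounds -/

section
open MeasureTheory Set Topology

/-- Geometric mean, with weights `1 - η` and `η`, of the mean value bound `A` and the trivial bound
`A * 12x/(1 + |t|)`. The decay `(1 + |t|)^(-η)` gained for `x^η` makes the later integral converge.
-/
theorem norm_sub_cpow_div_le {x h η : ℝ} (hx : 1 ≤ x) (hh : 1 ≤ h) (hhx : h ≤ x) (hη0 : 0 ≤ η)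
    (hη1 : η ≤ 1) {s : ℂ} (hs : 1 / 2 ≤ s.re) :
    ‖((x + h : ℝ) : ℂ) ^ (s + 1) / (s + 1) - (x : ℂ) ^ (s + 1) / (s + 1)‖
      ≤ h * (2 * x) ^ s.re * (12 * x) ^ η * (1 + |s.im|) ^ (-η) := by
  set D := ‖((x + h : ℝ) : ℂ) ^ (s + 1) / (s + 1) - (x : ℂ) ^ (s + 1) / (s + 1)‖ with hD
  have hD0 : 0 ≤ D := norm_nonneg _
  have hs1 := one_add_abs_im_le_norm_add_one hs
  have ht : 0 < 1 + |s.im| := by positivity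
  have hn : 0 < ‖s + 1‖ := by linarith
  set A : ℝ := h * (2 * x) ^ s.re with hA
  have hA0 : 0 < A := by positivity
  have hDA : D ≤ A := by
    have hne : s ≠ -1 := fun h => by
      rw [h] at hs; norm_num at hs
    have := Convex.norm_image_sub_le_of_norm_hasDerivWithin_le (𝕜 := ℝ) (s := Icc x (x + h))
      (f := fun u : ℝ => (u : ℂ) ^ (s + 1) / (s + 1)) (f' := fun u : ℝ => (u : ℂ) ^ s)
      (C := (2 * x) ^ s.re) (fun u hu => (hasDerivAt_ofReal_cpow_const'
        (by linarith [hu.1] : u ≠ 0) hne).hasDerivWithinAt)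
      (fun u hu => by
        have hu0 : 0 < u := by linarith [hu.1]
        rw [Complex.norm_cpow_eq_rpow_re_of_pos hu0]
        exact Real.rpow_le_rpow hu0.le (by linarith [hu.2]) (by linarith))
      (convex_Icc _ _) (x := x) (y := x + h) ⟨le_rfl, by linarith⟩ ⟨by linarith, le_rfl⟩
    rw [add_sub_cancel_left, Real.norm_of_nonneg (by linarith), mul_comm] at this
    exact this
  have hDB : D ≤ A * (12 * x / (1 + |s.im|)) := by
    have hpow {u : ℝ} (h0 : 0 < u) (hu : u ≤ 2 * x) :
        ‖(u : ℂ) ^ (s + 1) / (s + 1)‖ ≤ (2 * x) ^ s.re * (2 * x) / ‖s + 1‖ := by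
      rw [norm_div, Complex.norm_cpow_eq_rpow_re_of_pos h0, Complex.add_re, Complex.one_re,
        ← Real.rpow_add_one (by linarith)]
      gcongr
    refine (norm_sub_le _ _).trans ((add_le_add (hpow (by linarith) (by linarith))
      (hpow (by linarith) (by linarith))).trans ?_)
    have h1 : (2 * x) ^ s.re ≤ A := le_mul_of_one_le_left (by positivity) hh
    calc (2 * x) ^ s.re * (2 * x) / ‖s + 1‖ + (2 * x) ^ s.re * (2 * x) / ‖s + 1‖
        = (2 * x) ^ s.re * (12 * x / (3 * ‖s + 1‖)) := by field_simp; ring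
      _ ≤ A * (12 * x / (1 + |s.im|)) := by gcongr
  calc D = D ^ (1 - η) * D ^ η := by
        rw [← Real.rpow_add_of_nonneg hD0 (by linarith) hη0, sub_add_cancel, Real.rpow_one]
    _ ≤ A ^ (1 - η) * (A * (12 * x / (1 + |s.im|))) ^ η := by
        gcongr
    _ = A * (12 * x) ^ η * (1 + |s.im|) ^ (-η) := by
        rw [Real.mul_rpow hA0.le (by positivity), ← mul_assoc,
          ← Real.rpow_add hA0, sub_add_cancel, Real.rpow_one, Real.div_rpow (by positivity) ht.le,
          Real.rpow_neg ht.le]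
        ring

variable {f : ℕ → ℂ} {H : ℂ → ℂ}

/-- If the Dirichlet series of a bounded function continues to `Re s > 1/2` with growth
`O(|t| ^ η)` for every `η > 0`, then its summatory function is `O(x ^ (1/2 + ε))`. -/
theorem exists_norm_summatory_le_rpow (hf : ∀ n, ‖f n‖ ≤ 1)
    (hH : ∀ s : ℂ, 1 < s.re → LSeries f s = H s) (hd : DifferentiableOn ℂ H {s | 1 / 2 < s.re})
    (hgrow : ∀ σ η : ℝ, 1 / 2 < σ → 0 < η →
      ∃ C, ∀ s : ℂ, σ ≤ s.re → ‖H s‖ ≤ C * (1 + |s.im|) ^ η) {ε : ℝ} (hε : 0 < ε) :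
    ∃ C : ℝ, ∀ x : ℝ, 1 ≤ x → ‖summatory f x‖ ≤ C * x ^ (1 / 2 + ε) := by
  set e : ℝ := min ε 1 with he
  have he0 : 0 < e := by positivity
  have he1 : e ≤ 1 := min_le_right _ _
  have heε : e ≤ ε := min_le_left _ _
  -- Interpolating with `η = e/2` costs another `x^(e/2)`, for `x^(1/2+e)` in total. In `t` the
  -- exponents are `e/4` from `H`, `-1` from `1/s` and `-e/2`, which sum to `-(1 + e/4)`.
  set σ : ℝ := 1 / 2 + e / 2 with hσ
  obtain ⟨C, hC⟩ := hgrow σ (e / 4) (by linarith) (by linarith)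
  have hC0 : 0 ≤ C := by
    have := (norm_nonneg _).trans (hC σ (by simp))
    simpa using this
  set J : ℝ := ∫ t : ℝ, (1 + |t|) ^ (-(1 + e / 4)) with hJ
  have hJi := integrable_one_add_abs_rpow (by linarith : (1 : ℝ) < 1 + e / 4)
  have hJ0 : 0 ≤ J := integral_nonneg fun t => by positivity
  let Q : ℝ → ℂ → ℂ := fun x s => H s * ((x : ℂ) ^ (s + 1) * (1 / (s * (s + 1))))
  have hpi := Real.pi_pos
  have hshift (x : ℝ) (hx : 1 ≤ x) : Integrable (fun t : ℝ => Q x (σ + t * Complex.I)) ∧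
      2 * Real.pi * rieszSum f x = ∫ t : ℝ, Q x (σ + t * Complex.I) := by
    have hx0 : 0 < x := by linarith
    have hx0' : (x : ℂ) ≠ 0 := by exact_mod_cast hx0.ne'
    have := integral_vertical_eq (g := Q x) (σ := σ) (c := 2) (K := C * x ^ (3 : ℝ) * 9)
      (p := 2 - e / 4) (by linarith) (by linarith) (fun s h1 h2 => by
        have hs0 : s ≠ 0 := fun h => by simp [h] at h1; linarith
        have hs1 : s + 1 ≠ 0 := fun h => by
          have := congrArg Complex.re h; simp at this; linarith
        have hHs : DifferentiableAt ℂ H s := hd.differentiableAt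
          ((isOpen_lt_re (1 / 2)).mem_nhds (show 1 / 2 < s.re by linarith))
        refine hHs.mul (DifferentiableAt.mul ?_ ?_)
        · exact (differentiableAt_id.add_const _).const_cpow (Or.inl hx0')
        · exact (differentiableAt_const _).div (differentiableAt_id.mul
            (differentiableAt_id.add_const _)) (mul_ne_zero hs0 hs1)) (fun s h1 h2 => by
        have ht : 0 < 1 + |s.im| := by positivity
        rw [norm_mul, norm_mul, Complex.norm_cpow_eq_rpow_re_of_pos hx0]
        calc _ ≤ (C * (1 + |s.im|) ^ (e / 4)) * (x ^ (3 : ℝ) * (9 * (1 + |s.im|) ^ (-2 : ℝ))) := by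
              gcongr
              · exact hC s h1
              · rw [Complex.add_re, Complex.one_re]; linarith
              · exact norm_inv_mul_add_one_le (by linarith)
          _ = C * x ^ (3 : ℝ) * 9 * ((1 + |s.im|) ^ (e / 4) * (1 + |s.im|) ^ (-2 : ℝ)) := by ring
          _ = _ := by
            rw [← Real.rpow_add ht]
            congr 2
            ring)
    exact ⟨this.1, by rw [rieszSum_eq_integral hf hH hx0, this.2.2]⟩
  set K : ℝ := C * 3 * (2 ^ σ * 12 ^ (e / 2)) * J with hK
  have hK0 : 0 ≤ K := by positivity
  have hdiff (x h : ℝ) (hx : 1 ≤ x) (hh : 1 ≤ h) (hhx : h ≤ x) :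
      ‖rieszSum f (x + h) - rieszSum f x‖ ≤ h * x ^ (1 / 2 + e) * K := by
    have hx0 : 0 < x := by linarith
    obtain ⟨i1, e1⟩ := hshift x hx
    obtain ⟨i2, e2⟩ := hshift (x + h) (by linarith)
    have h1 : 2 * Real.pi * (rieszSum f (x + h) - rieszSum f x)
        = ∫ t : ℝ, (Q (x + h) (σ + t * Complex.I) - Q x (σ + t * Complex.I)) := by
      rw [mul_sub, e1, e2, integral_sub i2 i1]
    have h2 : ‖2 * Real.pi * (rieszSum f (x + h) - rieszSum f x)‖ ≤ h * x ^ (1 / 2 + e) * K := by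
      rw [h1]
      have hb : ∀ t : ℝ, ‖Q (x + h) (σ + t * Complex.I) - Q x (σ + t * Complex.I)‖
          ≤ (h * x ^ (1 / 2 + e) * (C * 3 * (2 ^ σ * 12 ^ (e / 2)))) *
            (1 + |t|) ^ (-(1 + e / 4)) := by
        intro t
        set s : ℂ := σ + t * Complex.I with hsdef
        have hre : s.re = σ := re_add_mul_I σ t
        have him : s.im = t := im_add_mul_I σ t
        have hs : 1 / 2 ≤ s.re := by rw [hre]; linarith
        have ht : 0 < 1 + |t| := by positivity
        have hs3 := one_add_abs_im_le hs
        rw [him] at hs3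
        have hsn : 0 < ‖s‖ := by linarith
        have hQ : Q (x + h) s - Q x s = H s * (1 / s) *
            (((x + h : ℝ) : ℂ) ^ (s + 1) / (s + 1) - (x : ℂ) ^ (s + 1) / (s + 1)) := by
          simp only [Q, one_div, mul_inv]
          ring
        have hinv : ‖1 / s‖ ≤ 3 * (1 + |t|) ^ (-1 : ℝ) := by
          rw [norm_div, norm_one, Real.rpow_neg_one, ← div_eq_mul_inv,
            div_le_div_iff₀ hsn ht, one_mul]
          exact hs3
        have hHs := hC s hre.ge
        have hDs := norm_sub_cpow_div_le hx hh hhx (by linarith : 0 ≤ e / 2) (by linarith) hs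
        rw [him] at hHs hDs
        rw [hre] at hDs
        rw [hQ, norm_mul, norm_mul]
        calc _ ≤ (C * (1 + |t|) ^ (e / 4)) * (3 * (1 + |t|) ^ (-1 : ℝ)) *
              (h * (2 * x) ^ σ * (12 * x) ^ (e / 2) * (1 + |t|) ^ (-(e / 2))) := by gcongr
          _ = (h * (x ^ σ * x ^ (e / 2)) * (C * 3 * (2 ^ σ * 12 ^ (e / 2)))) *
              ((1 + |t|) ^ (e / 4) * (1 + |t|) ^ (-1 : ℝ) * (1 + |t|) ^ (-(e / 2))) := by
            rw [Real.mul_rpow (by norm_num) hx0.le, Real.mul_rpow (by norm_num) hx0.le]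
            ring
          _ = _ := by
            rw [← Real.rpow_add ht, ← Real.rpow_add ht, ← Real.rpow_add hx0]
            congr 3
            · rw [hσ]; ring_nf
            · ring
      refine (norm_integral_le_of_norm_le (hJi.const_mul _) (ae_of_all _ hb)).trans (le_of_eq ?_)
      rw [integral_const_mul, hK]
      ring
    refine le_trans ?_ h2
    rw [norm_mul]
    refine le_mul_of_one_le_left (norm_nonneg _) ?_
    have : ‖(2 * Real.pi : ℂ)‖ = 2 * Real.pi := by
      rw [norm_mul, Complex.norm_real, Real.norm_of_nonneg hpi.le]; simp
    rw [this]
    linarith [Real.pi_gt_three]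
  refine ⟨K + 2, fun x hx => ?_⟩
  have hx0 : 0 < x := by linarith
  -- After division by `h`, the smoothing error is `h + 1 ≤ 2 x^(1/2+e)`, no larger in order than
  -- the main bound.
  set h := √x with hh
  have hh1 : 1 ≤ h := Real.one_le_sqrt.mpr hx
  have hhx : h ≤ x := by
    have := Real.mul_self_sqrt hx0.le
    nlinarith
  have hh0 : 0 < h := by linarith
  have hhp : h ≤ x ^ (1 / 2 + e) := by
    rw [hh, Real.sqrt_eq_rpow]
    exact Real.rpow_le_rpow_of_exponent_le hx (by linarith)
  have h1 := hdiff x h hx hh1 hhx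
  have h2 := norm_rieszSum_sub_le hf hx0.le hh0.le
  have h3 : ‖(h : ℂ) * summatory f x‖ = h * ‖summatory f x‖ := by
    rw [norm_mul, Complex.norm_real, Real.norm_of_nonneg hh0.le]
  have h4 := norm_sub_le (rieszSum f (x + h) - rieszSum f x)
    (rieszSum f (x + h) - rieszSum f x - h * summatory f x)
  rw [sub_sub_cancel, h3] at h4
  have h5 : h * ‖summatory f x‖ ≤ h * ((K + 2) * x ^ (1 / 2 + e)) := by nlinarith
  refine (le_of_mul_le_mul_left h5 hh0).trans ?_
  gcongr

end

/-! ### Conclusion -/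

/-- On the generalized Riemann hypothesis, `L(s, χ)` does not vanish in `Re s > 1/2`. -/
theorem LFunction_ne_zero_of_GRH (h : GeneralizedRiemannHypothesis) {q : ℕ} [NeZero q]
    {χ : DirichletCharacter ℂ q} (hχ : χ ≠ 1) {s : ℂ} (hs : 1 / 2 < s.re) :
    DirichletCharacter.LFunction χ s ≠ 0 := by
  intro h0
  rcases lt_or_ge s.re 1 with h1 | h1
  · have := h q χ s (by linarith) h1 h0
    linarith
  · exact DirichletCharacter.LFunction_ne_zero_of_one_le_re χ (Or.inl hχ) h1 h0

/-- On the Riemann hypothesis for `L(s, χ)`, its logarithm is holomorphic in `Re s > 1/2` and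
`o(log |t|)` there. -/
theorem exists_log_LFunction_le {q : ℕ} [NeZero q] {χ : DirichletCharacter ℂ q} (hχ : χ ≠ 1)
    (hL : ∀ s : ℂ, 1 / 2 < s.re → DirichletCharacter.LFunction χ s ≠ 0) :
    ∃ l : ℂ → ℂ, DifferentiableOn ℂ l {s | 1 / 2 < s.re} ∧
      (∀ s : ℂ, 1 < s.re → l s = primeLogSum (fun n => χ n) s) ∧
      ∀ σ η : ℝ, 1 / 2 < σ → 0 < η →
        ∃ C, ∀ s : ℂ, σ ≤ s.re → ‖l s‖ ≤ η * Real.log (|s.im| + 8) + C := by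
  obtain ⟨l, hl, hre, heq⟩ := exists_differentiableOn_eq_primeLogSum hχ hL
  refine ⟨l, hl, heq, fun σ η hσ hη => ?_⟩
  -- The constant of `norm_LFunction_le` at `σ = 1/2`.
  set A : ℝ := 2 * (q + 1) with hA
  have hA1 : 1 ≤ A := by have : (0 : ℝ) ≤ q := q.cast_nonneg
                         linarith
  have hbound (s : ℂ) (h1 : 1 / 2 < s.re) (h2 : s.re ≤ 4) :
      (l s).re ≤ Real.log (A * (|s.im| + 8)) := by
    rw [Real.le_log_iff_exp_le (by positivity), ← hre s h1]
    refine (norm_LFunction_le hχ (by norm_num : (0 : ℝ) < 1 / 2) h1.le).trans ?_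
    have h3 : ‖s‖ ≤ |s.im| + 8 := by
      refine (Complex.norm_le_abs_re_add_abs_im s).trans ?_
      rw [abs_of_nonneg (by linarith)]
      linarith
    calc (q + 1 : ℝ) / (1 / 2) * ‖s‖ = A * ‖s‖ := by rw [hA]; ring
      _ ≤ _ := by gcongr
  obtain ⟨C, hC⟩ := norm_le_mul_log_add hl hA1 hbound
    (B := ∑' p : Nat.Primes, 3 * ((p : ℕ) : ℝ) ^ (-(2 : ℝ)))
    (fun s hs => by
      rw [heq s (by linarith)]
      exact norm_primeLogSum_le (fun n => χ.norm_le_one _) (by norm_num) hs)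
    (δ := (σ - 1 / 2) / 2) (by linarith) hη
  exact ⟨C, fun s hs => hC s (by linarith)⟩

theorem mainTheorem4 (q r : ℕ) (hq : 2 ≤ q) (a : Fin r → ZMod q)
    (ha_distinct : Function.Injective a) (ha_coprime : ∀ i, IsUnit (a i))
    (hr : 2 * r = Nat.totient q)
    (hchar : ¬ IsCharacterLike q (liouvilleAPs q a)) :
    (GeneralizedRiemannHypothesis → ∀ ε : ℝ, 0 < ε →
      ∃ C : ℝ, ∀ x : ℝ, 1 ≤ x → |liouvilleSum q a x| ≤ C * x ^ (1 / 2 + ε)) ∧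
    (liouvilleSum q a =o[atTop] fun x : ℝ => x) := by
  have : NeZero q := ⟨by omega⟩
  set f := liouvilleHom q a with hf
  have hf1 : ∀ n, ‖f n‖ ≤ 1 := norm_liouvilleHom_le q a
  have hsum (x : ℝ) : summatory f x = (liouvilleSum q a x : ℂ) := (ofReal_liouvilleSum q a x).symm
  have hnorm (x : ℝ) : ‖summatory f x‖ = |liouvilleSum q a x| := by
    rw [hsum, Complex.norm_real, Real.norm_eq_abs]
  obtain ⟨c, hc1, hc⟩ := exists_coeff_liouvilleHom q r hq a ha_distinct ha_coprime hr
  obtain ⟨G, hGd, hGb, hG⟩ := LSeries_eq_exp_sum_primeLogSum q f hf1 c hc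
  -- Since `c 1 = 0`, the function `l 1` is arbitrary; it is taken to be `0` in both parts.
  have hprincipal {l : DirichletCharacter ℂ q → ℂ → ℂ}
      (hl : ∀ χ, χ ≠ 1 → ∀ s : ℂ, 1 < s.re → l χ s = primeLogSum (fun n => χ n) s)
      (s : ℂ) (hs : 1 < s.re) : LSeries f s
        = Complex.exp (∑ χ : DirichletCharacter ℂ q, c χ * l χ s + G s) := by
    rw [hG s hs]
    congr 2
    refine Finset.sum_congr rfl fun χ _ => ?_
    by_cases hχ : χ = 1
    · simp [hχ, hc1]
    · rw [hl χ hχ s hs]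
  constructor
  · intro hGRH ε hε
    have hex (χ : DirichletCharacter ℂ q) : ∃ l : ℂ → ℂ,
        DifferentiableOn ℂ l {s | 1 / 2 < s.re} ∧
        (χ ≠ 1 → ∀ s : ℂ, 1 < s.re → l s = primeLogSum (fun n => χ n) s) ∧
        ∀ σ η : ℝ, 1 / 2 < σ → 0 < η →
          ∃ C, ∀ s : ℂ, σ ≤ s.re → ‖l s‖ ≤ η * Real.log (|s.im| + 8) + C := by
      by_cases hχ : χ = 1
      · refine ⟨0, differentiableOn_const 0, fun h => absurd hχ h, fun σ η _ hη => ⟨0, fun s _ => ?_⟩⟩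
        have : 0 ≤ Real.log (|s.im| + 8) := Real.log_nonneg (by linarith [abs_nonneg s.im])
        simp only [Pi.zero_apply, norm_zero, add_zero]
        positivity
      · obtain ⟨l, h1, h2, h3⟩ := exists_log_LFunction_le hχ
          fun s hs => LFunction_ne_zero_of_GRH hGRH hχ hs
        exact ⟨l, h1, fun _ => h2, h3⟩
    choose l hld hleq hlb using hex
    obtain ⟨C, hC⟩ := exists_norm_summatory_le_rpow hf1 (hprincipal hleq)
      ((DifferentiableOn.add (DifferentiableOn.fun_sum fun χ _ => (hld χ).const_mul _) hGd).cexp)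
      (fun σ η hσ hη => by
        set S : ℝ := ∑ χ : DirichletCharacter ℂ q, ‖c χ‖ with hS
        have hS0 : 0 ≤ S := Finset.sum_nonneg fun χ _ => norm_nonneg _
        -- With this share for each character the weighted total is at most `η`; `S + 1` avoids
        -- dividing by zero.
        choose D hD using fun χ => hlb χ σ (η / (S + 1)) hσ (by positivity)
        obtain ⟨B, hB⟩ := hGb σ hσ
        refine ⟨Real.exp (∑ χ : DirichletCharacter ℂ q, ‖c χ‖ * D χ + B) * 8 ^ η,
          fun s hs => ?_⟩
        have hlog : 0 ≤ Real.log (|s.im| + 8) := Real.log_nonneg (by linarith [abs_nonneg s.im])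
        have h8 : 0 < |s.im| + 8 := by positivity
        have h1 : (∑ χ : DirichletCharacter ℂ q, c χ * l χ s + G s).re
            ≤ η * Real.log (|s.im| + 8) + (∑ χ : DirichletCharacter ℂ q, ‖c χ‖ * D χ + B) := by
          refine (Complex.re_le_norm _).trans ((norm_add_le _ _).trans ?_)
          have h2 : ‖∑ χ : DirichletCharacter ℂ q, c χ * l χ s‖
              ≤ ∑ χ : DirichletCharacter ℂ q,
                (‖c χ‖ * (η / (S + 1) * Real.log (|s.im| + 8)) + ‖c χ‖ * D χ) := by
            refine (norm_sum_le _ _).trans (Finset.sum_le_sum fun χ _ => ?_)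
            rw [norm_mul, ← mul_add]
            exact mul_le_mul_of_nonneg_left (hD χ s hs) (norm_nonneg _)
          rw [Finset.sum_add_distrib, ← Finset.sum_mul, ← hS] at h2
          have h3 : S * (η / (S + 1) * Real.log (|s.im| + 8)) ≤ η * Real.log (|s.im| + 8) := by
            rw [← mul_assoc]
            refine mul_le_mul_of_nonneg_right ?_ hlog
            rw [mul_div_assoc', div_le_iff₀ (by positivity)]
            nlinarith
          linarith [hB s hs]
        rw [Complex.norm_exp]
        calc _ ≤ Real.exp (η * Real.log (|s.im| + 8)
                + (∑ χ : DirichletCharacter ℂ q, ‖c χ‖ * D χ + B)) := Real.exp_le_exp.mpr h1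
          _ = Real.exp (∑ χ : DirichletCharacter ℂ q, ‖c χ‖ * D χ + B) * (|s.im| + 8) ^ η := by
            rw [Real.exp_add, Real.rpow_def_of_pos h8, mul_comm (Real.log _), mul_comm]
          _ ≤ Real.exp (∑ χ : DirichletCharacter ℂ q, ‖c χ‖ * D χ + B) *
              (8 * (1 + |s.im|)) ^ η := by
            gcongr
            linarith [abs_nonneg s.im]
          _ = _ := by rw [Real.mul_rpow (by norm_num) (by positivity)]; ring) hε
    exact ⟨C, fun x hx => by rw [← hnorm]; exact hC x hx⟩
  · have hex (χ : DirichletCharacter ℂ q) : ∃ l : ℂ → ℂ, ContinuousOn l {s | 1 ≤ s.re} ∧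
        (χ ≠ 1 → ∀ s : ℂ, 1 < s.re → l s = primeLogSum (fun n => χ n) s) := by
      by_cases hχ : χ = 1
      · exact ⟨0, continuousOn_const, fun h => absurd hχ h⟩
      · obtain ⟨l, h1, h2⟩ := exists_continuousOn_eq_primeLogSum hχ
        exact ⟨l, h1, fun _ => h2⟩
    choose l hlc hleq using hex
    have hGc : ContinuousOn G {s | 1 ≤ s.re} := hGd.continuousOn.mono fun s hs => by
      simp only [Set.mem_ofPred_eq] at hs ⊢
      linarith
    have := summatory_isLittleO hf1
      ((ContinuousOn.add (continuousOn_finsetSum _ fun χ _ => (hlc χ).const_mul _) hGc).cexp)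
      (hprincipal hleq)
    refine isLittleO_norm_left.mp ((isLittleO_norm_left.mpr this).congr_left fun x => ?_)
    rw [hnorm, Real.norm_eq_abs]
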